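/- Fix $n\ge 1$, $\omega,\hbar>0$, and $C^1$ functions $\eta_i,\eta_f:[0,1]\to\mathbb R$ with $\eta_i(0)=\eta_f(1)=1$, $\eta_i(1)=\eta_f(0)=0$ that never vanish simultaneously. Consider $3n$ qubits, grouped in $n$ sectors of three qubits $(k,1),(k,2),(k,3)$, $k=1,\dots,n$. In sector $k$ let $H_k(s)=\eta_i(s)H_i+\eta_f(s)H_f$ with $$H_i=-\omega\hbar\,(\mathbb 1XX+\mathbb 1ZZ),\qquad H_f=-\omega\hbar\,(XX\mathbb 1+ZZ\mathbb 1),$$ where $X,Z$ are Pauli matrices, and let $H_{\rm mult}(s)=\sum_{k=1}^n H_k(s)$. Let $U_n$ be a unitary $n$-qubit gate, acting on the qubits $(1,3),\dots,(n,3)$ (and as the identity on all others), and put $H_{\rm mult}(s,U_n)=U_nH_{\rm mult}(s)U_n^\dagger$. Let $|\beta_{00}\rangle=(|00\rangle+|11\rangle)/\sqrt2$. Then: 1. For every $s\in[0,1]$ and every $k$, $H_{\rm mult}(s,U_n)$ commutes with the rotated parities $U_n\Pi_z^{(k)}U_n^\dagger$ and $U_n\Pi_x^{(k)}U_n^\dagger$,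 where $\Pi_z^{(k)}=ZZZ$ and $\Pi_x^{(k)}=XXX$ on sector $k$. 2. For every $s\in[0,1]$, the lowest eigenvalue of $H_{\rm mult}(s,U_n)$ is $-2n\omega\hbar\sqrt{\eta_i(s)^2+\eta_f(s)^2}$, and the gap between it and the next distinct eigenvalue is $2\omega\hbar\sqrt{\eta_i(s)^2+\eta_f(s)^2}$. 3. For a total time $\tau>0$ and a unit vector $|\psi\rangle\in(\mathbb C^2)^{\otimes n}$, consider the Schrödinger equation $$i\hbar\,\frac{d}{dt}|\phi(t)\rangle=H_{\rm mult}(t/\tau,U_n)\,|\phi(t)\rangle,\quad 0\le t\le\tau,\qquad |\phi(0)\rangle=U_n\Big(|\psi\rangle_{(1,1)\dots(n,1)}\bigotimes_{k=1}^n|\beta_{00}\rangle_{(k,2)(k,3)}\Big).$$ It has a solution. In the adiabatic limit $\tau\to\infty$ it teleports the gate up to a global phase: there are phases $\theta(\tau)\in\mathbb R$, independent of $|\psi\rangle$, such that $$\Big\|\,|\phi(\tau)\rangle-e^{i\theta(\tau)}\Big(\bigotimes_{k=1}^n|\beta_{00}\rangle_{(k,1)(k,2)}\Big)\otimes\big(U_n|\psi\rangle\big)_{(1,3)\dots(n,3)}\Big\|\longrightarrow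 0\qquad(\tau\to\infty),$$ uniformly in $|\psi\rangle$. The case $n=1$, $U_1=\mathbb 1$ is the teleportation of a one-qubit state by $H_0(s)=\eta_i(s)H_i+\eta_f(s)H_f$. -/

import Mathlib

open Matrix

noncomputable section

namespace AdiabaticTeleportation

/-- Pure states of a register of qubits labelled by `ι`: vectors of amplitudes indexed by the
computational basis, with the usual Hermitian norm. -/
abbrev QState (ι : Type*) [Fintype ι] [DecidableEq ι] : Type _ :=
  EuclideanSpace ℂ (ι → Fin 2)

/-- Operators on a register of qubits labelled by `ι`, as matrices in the computational basis. -/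
abbrev QOp (ι : Type*) : Type _ := Matrix (ι → Fin 2) (ι → Fin 2) ℂ

/-- The Pauli matrix `X`. -/
def pauliX : Matrix (Fin 2) (Fin 2) ℂ := !![0, 1; 1, 0]

/-- The Pauli matrix `Z`. -/
def pauliZ : Matrix (Fin 2) (Fin 2) ℂ := !![1, 0; 0, -1]

/-- The one-qubit operator `A` acting on qubit `q`, tensored with the identity on all others. -/
def onQubit {ι : Type*} [Fintype ι] [DecidableEq ι] (q : ι) (A : Matrix (Fin 2) (Fin 2) ℂ) :
    QOp ι :=
  Matrix.of fun x y => if ∀ r, r ≠ q → x r = y r then A (x q) (y q) else 0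

/-- The qubits of `n` sectors with three qubits each. In sector `k`, qubit `(k, 0)` carries the
input, and `(k, 1)`, `(k, 2)` carry the Bell pair; `(k, 2)` belongs to the receiver. -/
abbrev Qubits (n : ℕ) : Type := Fin n × Fin 3

/-- `H_i` in sector `k`: `-ωħ (1XX + 1ZZ)`. -/
def sectorHi {n : ℕ} (ω ħ : ℝ) (k : Fin n) : QOp (Qubits n) :=
  (-(ω * ħ : ℂ)) • (onQubit (k, 1) pauliX * onQubit (k, 2) pauliX
    + onQubit (k, 1) pauliZ * onQubit (k, 2) pauliZ)

/-- `H_f` in sector `k`: `-ωħ (XX1 + ZZ1)`. -/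
def sectorHf {n : ℕ} (ω ħ : ℝ) (k : Fin n) : QOp (Qubits n) :=
  (-(ω * ħ : ℂ)) • (onQubit (k, 0) pauliX * onQubit (k, 1) pauliX
    + onQubit (k, 0) pauliZ * onQubit (k, 1) pauliZ)

/-- `H_0(s) = η_i(s) H_i + η_f(s) H_f` in sector `k`. -/
def sectorH {n : ℕ} (ω ħ : ℝ) (ηi ηf : ℝ → ℝ) (k : Fin n) (s : ℝ) : QOp (Qubits n) :=
  (ηi s : ℂ) • sectorHi ω ħ k + (ηf s : ℂ) • sectorHf ω ħ k

/-- `H_mult(s)`, the sum of the Hamiltonians of all the sectors. -/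
def Hmult (n : ℕ) (ω ħ : ℝ) (ηi ηf : ℝ → ℝ) (s : ℝ) : QOp (Qubits n) :=
  ∑ k : Fin n, sectorH ω ħ ηi ηf k s

/-- The `n`-qubit operator `U` acting on the receiver's qubits `(k, 2)`, tensored with the identity
on all other qubits. -/
def receiverGate {n : ℕ} (U : QOp (Fin n)) : QOp (Qubits n) :=
  Matrix.of fun x y =>
    if ∀ k : Fin n, x (k, 0) = y (k, 0) ∧ x (k, 1) = y (k, 1) then
      U (fun k => x (k, 2)) (fun k => y (k, 2))
    else 0

/-- The rotation `U A U†` of an operator on the full register by a gate `U` on the receiver's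
qubits. -/
def rotated {n : ℕ} (U : QOp (Fin n)) (A : QOp (Qubits n)) : QOp (Qubits n) :=
  receiverGate U * A * (receiverGate U)ᴴ

/-- The parity `Π_z = ZZZ` of sector `k`. -/
def parityZ {n : ℕ} (k : Fin n) : QOp (Qubits n) :=
  onQubit (k, 0) pauliZ * onQubit (k, 1) pauliZ * onQubit (k, 2) pauliZ

/-- The parity `Π_x = XXX` of sector `k`. -/
def parityX {n : ℕ} (k : Fin n) : QOp (Qubits n) :=
  onQubit (k, 0) pauliX * onQubit (k, 1) pauliX * onQubit (k, 2) pauliX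

/-- Amplitudes of the Bell state `(|00⟩ + |11⟩) / √2`. -/
def bell (a b : Fin 2) : ℂ := if a = b then 1 / (Real.sqrt 2 : ℂ) else 0

/-- `|ψ⟩` on the qubits `(k, 0)`, and a Bell pair on the qubits `(k, 1)`, `(k, 2)` for every `k`. -/
def inputState {n : ℕ} (ψ : QState (Fin n)) : QState (Qubits n) :=
  WithLp.toLp 2 fun x => ψ (fun k => x (k, 0)) * ∏ k : Fin n, bell (x (k, 1)) (x (k, 2))

/-- A Bell pair on the qubits `(k, 0)`, `(k, 1)` for every `k`, and `|ψ⟩` on the qubits `(k, 2)`. -/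
def outputState {n : ℕ} (ψ : QState (Fin n)) : QState (Qubits n) :=
  WithLp.toLp 2 fun x => (∏ k : Fin n, bell (x (k, 0)) (x (k, 1))) * ψ (fun k => x (k, 2))

/-- The action of an operator on states, `A|ψ⟩`. -/
def act {ι : Type*} [Fintype ι] [DecidableEq ι] (A : QOp ι) (ψ : QState ι) : QState ι :=
  Matrix.toEuclideanCLM (n := ι → Fin 2) (𝕜 := ℂ) A ψ

/-- `φ` solves the Schrödinger equation `iħ φ'(t) = H(t/τ) φ(t)` on `0 ≤ t ≤ τ`, with
`φ(0) = φ₀`. -/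
def IsEvolution {ι : Type*} [Fintype ι] [DecidableEq ι] (ħ τ : ℝ) (H : ℝ → QOp ι)
    (φ₀ : QState ι) (φ : ℝ → QState ι) : Prop :=
  φ 0 = φ₀ ∧ ∀ t ∈ Set.Icc 0 τ,
    HasDerivWithinAt φ ((-(Complex.I / (ħ : ℂ))) • act (H (t / τ)) (φ t)) (Set.Icc 0 τ) t

/-- The (real) energies of an operator: its eigenvalues. -/
def energies {ι : Type*} [Fintype ι] [DecidableEq ι] (H : QOp ι) : Set ℝ :=
  {E | Module.End.HasEigenvalue (Matrix.toLin' H) (E : ℂ)}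

/-- `H` has ground energy `E₀`, and `ε` is its gap: the first energy above `E₀` is `E₀ + ε`. -/
def HasGroundEnergyAndGap {ι : Type*} [Fintype ι] [DecidableEq ι] (H : QOp ι) (E₀ ε : ℝ) : Prop :=
  IsLeast (energies H) E₀ ∧ IsLeast {E ∈ energies H | E₀ < E} (E₀ + ε)

end AdiabaticTeleportation

end

/-! Each sector contributes two terms of `H_i` and two of `H_f`. Matching 1XX with ZZ1 and 1ZZ with
XX1 gives `2n` pairs of involutions `A j`, `D j` that anticommute within a pair and commute
otherwise (`anticommutingPairs_terms`). Thus `H(s) = -ωħ ∑ (η_i A j + η_f D j)` is a sum of `2n`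
independent spins in a rotating field of strength `r = √(η_i² + η_f²)`. Each summand squares to
`r²`, so the spectrum is contained in `-ωħ r (2n - 2m)`. The flip `D j * A j` reverses the sign of
one spin, which realizes both `m = 0` and `m = 1`. Conjugation by the gate is a star automorphism
and preserves all of this.

For the dynamics, write `(η_i, η_f) = r (cos ξ, sin ξ)` and `J = ∑ D j * A j`. Conjugation by `exp
((ξ/2) J)` turns `∑ A j` into `cos ξ ∑ A j + sin ξ ∑ D j` (`rotated_mul_exp_smul`), so `Ω = exp
((ξ/2) J) χ` follows the ground state. Moreover `J Ω` lies entirely in the first excited level.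
Hence the overlap of `Ω` with the evolution is driven by one amplitude oscillating at rate `2τρ`,
with `ρ = ω r`, and averaging (`exists_forall_norm_sub_le_of_oscillating`) shows that only the
dynamical phase survives.

At the end `cos (ξ/2) = sin (ξ/2)`. On the initial state the exponential becomes a product over
sectors of `(1/2)(1 + ZZ1)(1 + XX1)`, twice the Bell projector of the first two qubits. This is
teleportation (`partialState_insert`), and the gate then passes to the receiver's state. -/

/-! ### Calculus on a compact interval and the polar angle. -/

open Set Complex in
theorem exists_hasDerivWithinAt_Icc {f : ℝ → ℝ} {a b : ℝ} (hab : a ≤ b)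
    (hf : ContinuousOn f (Icc a b)) :
    ∃ F : ℝ → ℝ, F a = 0 ∧ ∀ s ∈ Icc a b, HasDerivWithinAt F (f s) (Icc a b) s := by
  -- The constant extension of `f` beyond the interval makes the fundamental theorem of calculus
  -- available at the endpoints too.
  have hg : Continuous (IccExtend hab ((Icc a b).domRestrict f)) :=
    (continuousOn_iff_continuous_domRestrict.1 hf).Icc_extend'
  refine ⟨fun u => ∫ x in a..u, IccExtend hab ((Icc a b).domRestrict f) x,
    intervalIntegral.integral_same, fun s hs => ?_⟩
  have h := (hg.integral_hasStrictDerivAt a s).hasDerivAt.hasDerivWithinAt (s := Icc a b)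
  rwa [IccExtend_of_mem hab _ hs] at h

theorem eq_left_of_hasDerivWithinAt_zero {E : Type*} [NormedAddCommGroup E] [NormedSpace ℝ E]
    {f : ℝ → E} {a b : ℝ} (hf : ∀ s ∈ Set.Icc a b, HasDerivWithinAt f 0 (Set.Icc a b) s) {s : ℝ}
    (hs : s ∈ Set.Icc a b) : f s = f a := by
  have h := (convex_Icc a b).norm_image_sub_le_of_norm_hasDerivWithin_le (f := f)
    (f' := fun _ => 0) (C := 0) hf (by simp) (Set.left_mem_Icc.2 (hs.1.trans hs.2)) hs
  rw [zero_mul] at h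
  exact sub_eq_zero.1 (norm_le_zero_iff.1 h)

open Set in
/-- A `C¹` curve `(a, b)` in the punctured plane has a `C¹` polar angle. -/
theorem exists_polar_angle {a b : ℝ → ℝ} (ha : ContDiffOn ℝ 1 a (Icc 0 1))
    (hb : ContDiffOn ℝ 1 b (Icc 0 1)) (ha0 : a 0 = 1) (hb0 : b 0 = 0)
    (hne : ∀ s ∈ Icc (0 : ℝ) 1, ¬ (a s = 0 ∧ b s = 0)) :
    ∃ ξ ξ' : ℝ → ℝ, ContinuousOn ξ' (Icc 0 1) ∧ ξ 0 = 0 ∧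
      (∀ s ∈ Icc (0 : ℝ) 1, HasDerivWithinAt ξ (ξ' s) (Icc 0 1) s) ∧
      ∀ s ∈ Icc (0 : ℝ) 1, a s = Real.sqrt (a s ^ 2 + b s ^ 2) * Real.cos (ξ s) ∧
        b s = Real.sqrt (a s ^ 2 + b s ^ 2) * Real.sin (ξ s) := by
  have hpos : ∀ s ∈ Icc (0 : ℝ) 1, 0 < a s ^ 2 + b s ^ 2 := by
    intro s hs
    rcases not_and_or.1 (hne s hs) with h | h <;> positivity
  set a' := derivWithin a (Icc 0 1)
  set b' := derivWithin b (Icc 0 1)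
  have ha' : ∀ s ∈ Icc (0 : ℝ) 1, HasDerivWithinAt a (a' s) (Icc 0 1) s := fun s hs =>
    (ha.differentiableOn one_ne_zero s hs).hasDerivWithinAt
  have hb' : ∀ s ∈ Icc (0 : ℝ) 1, HasDerivWithinAt b (b' s) (Icc 0 1) s := fun s hs =>
    (hb.differentiableOn one_ne_zero s hs).hasDerivWithinAt
  have hca : ContinuousOn a' (Icc 0 1) :=
    ha.continuousOn_derivWithin (uniqueDiffOn_Icc zero_lt_one) le_rfl
  have hcb : ContinuousOn b' (Icc 0 1) :=
    hb.continuousOn_derivWithin (uniqueDiffOn_Icc zero_lt_one) le_rfl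
  have hac := ha.continuousOn
  have hbc := hb.continuousOn
  -- This is the derivative that any polar angle of `(a, b)` must have. Its primitive is then shown
  -- to be one.
  set ξ' : ℝ → ℝ := fun s => (a s * b' s - b s * a' s) / (a s ^ 2 + b s ^ 2) with hξ'
  have hξc : ContinuousOn ξ' (Icc 0 1) :=
    ((hac.mul hcb).sub (hbc.mul hca)).div ((hac.pow 2).add (hbc.pow 2)) fun s hs => (hpos s hs).ne'
  obtain ⟨ξ, hξ0, hξ⟩ := exists_hasDerivWithinAt_Icc zero_le_one hξc
  refine ⟨ξ, ξ', hξc, hξ0, hξ, ?_⟩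
  set r : ℝ → ℝ := fun s => Real.sqrt (a s ^ 2 + b s ^ 2) with hr
  have hrpos : ∀ s ∈ Icc (0 : ℝ) 1, 0 < r s := fun s hs => Real.sqrt_pos.2 (hpos s hs)
  have hrsq : ∀ s ∈ Icc (0 : ℝ) 1, r s ^ 2 = a s ^ 2 + b s ^ 2 := fun s hs =>
    Real.sq_sqrt (hpos s hs).le
  have hr' : ∀ s ∈ Icc (0 : ℝ) 1,
      HasDerivWithinAt r ((a s * a' s + b s * b' s) / r s) (Icc 0 1) s := by
    intro s hs
    have h := (((ha' s hs).pow 2).add ((hb' s hs).pow 2)).sqrt (hpos s hs).ne'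
    refine h.congr_deriv ?_
    have := (hrpos s hs).ne'
    change _ / (2 * r s) = _
    field_simp
    push_cast
    ring
  have hξr : ∀ s ∈ Icc (0 : ℝ) 1, ξ' s = (a s * b' s - b s * a' s) / r s ^ 2 := by
    intro s hs
    rw [hrsq s hs]
  -- In the frame turned by `ξ`, the unit vector `(a, b) / r` has constant coordinates `(1, 0)`;
  -- `key1` and `key2` are the two coordinates.
  have key1 : ∀ s ∈ Icc (0 : ℝ) 1,
      (a s * Real.cos (ξ s) + b s * Real.sin (ξ s)) / r s = 1 := by
    intro s hs
    have := eq_left_of_hasDerivWithinAt_zero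
      (f := fun s => (a s * Real.cos (ξ s) + b s * Real.sin (ξ s)) / r s) (a := 0) (b := 1)
      (fun s hs => ((((ha' s hs).mul (hξ s hs).cos).add ((hb' s hs).mul (hξ s hs).sin)).div
        (hr' s hs) (hrpos s hs).ne').congr_deriv ?_) hs
    · rw [this]; simp [hr, ha0, hb0, hξ0]
    · have h1 := (hrpos s hs).ne'
      have h2 := hrsq s hs
      rw [hξr s hs]
      simp only [Pi.add_apply, Pi.mul_apply]
      field_simp
      simp only [h2]
      ring
  have key2 : ∀ s ∈ Icc (0 : ℝ) 1,
      (b s * Real.cos (ξ s) - a s * Real.sin (ξ s)) / r s = 0 := by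
    intro s hs
    have := eq_left_of_hasDerivWithinAt_zero
      (f := fun s => (b s * Real.cos (ξ s) - a s * Real.sin (ξ s)) / r s) (a := 0) (b := 1)
      (fun s hs => ((((hb' s hs).mul (hξ s hs).cos).sub ((ha' s hs).mul (hξ s hs).sin)).div
        (hr' s hs) (hrpos s hs).ne').congr_deriv ?_) hs
    · rw [this]; simp [hr, ha0, hb0, hξ0]
    · have h1 := (hrpos s hs).ne'
      have h2 := hrsq s hs
      rw [hξr s hs]
      simp only [Pi.sub_apply, Pi.mul_apply]
      field_simp
      simp only [h2]
      ring
  intro s hs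
  have h1 := (div_eq_iff (hrpos s hs).ne').1 (key1 s hs)
  have h2 := (div_eq_iff (hrpos s hs).ne').1 (key2 s hs)
  have h3 := Real.sin_sq_add_cos_sq (ξ s)
  change a s = r s * _ ∧ b s = r s * _
  constructor
  · linear_combination Real.cos (ξ s) * h1 - Real.sin (ξ s) * h2 - a s * h3
  · linear_combination Real.sin (ξ s) * h1 + Real.cos (ξ s) * h2 - b s * h3

/-! ### Averaging of an oscillating drive. -/

open Set Complex in
/-- The averaging principle behind the adiabatic theorem: `z` is driven by an amplitude `w` that
oscillates at the frequency `2τρ`, so it stays put as `τ → ∞`, uniformly in the data. -/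
theorem exists_forall_norm_sub_le_of_oscillating {ρ q : ℝ → ℝ} (hρ : ContinuousOn ρ (Icc 0 1))
    (hq : ContinuousOn q (Icc 0 1)) (hpos : ∀ s ∈ Icc (0 : ℝ) 1, 0 < ρ s) {B δ : ℝ} (hB : 0 ≤ B)
    (hδ : 0 < δ) :
    ∃ T : ℝ, 0 < T ∧ ∀ τ, T ≤ τ → ∀ z w v : ℝ → ℂ,
      (∀ s ∈ Icc (0 : ℝ) 1, HasDerivWithinAt z (q s * w s) (Icc 0 1) s) →
      (∀ s ∈ Icc (0 : ℝ) 1,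
        HasDerivWithinAt w (-(2 * I * τ * ρ s) * w s + q s * v s) (Icc 0 1) s) →
      (∀ s ∈ Icc (0 : ℝ) 1, ‖w s‖ ≤ B) → (∀ s ∈ Icc (0 : ℝ) 1, ‖v s‖ ≤ B) →
      ‖z 1 - z 0‖ ≤ δ := by
  obtain ⟨R, hR⟩ := isCompact_Icc.exists_bound_of_continuousOn hρ
  obtain ⟨Q, hQ⟩ := isCompact_Icc.exists_bound_of_continuousOn hq
  have h0 : (0 : ℝ) ∈ Icc (0 : ℝ) 1 := by simp
  have h1 : (1 : ℝ) ∈ Icc (0 : ℝ) 1 := by simp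
  have hR0 : 0 ≤ R := (norm_nonneg _).trans (hR 0 h0)
  have hQ0 : 0 ≤ Q := (norm_nonneg _).trans (hQ 0 h0)
  -- Half of the error budget goes to approximating `q / ρ`; the `+ 1` keeps the denominator
  -- positive when `R * B = 0`.
  set ε := δ / (2 * (R * B + 1)) with hε
  have hε0 : 0 < ε := by positivity
  have hεR : ε * (R * B) ≤ δ / 2 := by
    rw [hε, div_mul_eq_mul_div, div_le_div_iff₀ (by positivity) (by positivity)]
    nlinarith [mul_nonneg hR0 hB]
  -- Integration by parts would differentiate `q / ρ`, which is only continuous, so a polynomial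
  -- takes its place.
  obtain ⟨p, hp⟩ := exists_polynomial_near_of_continuousOn 0 1 (fun s => q s / ρ s)
    (hq.div hρ fun s hs => (hpos s hs).ne') ε hε0
  obtain ⟨P, hP⟩ := isCompact_Icc.exists_bound_of_continuousOn
    (p.continuous.continuousOn (s := Icc (0 : ℝ) 1))
  obtain ⟨P', hP'⟩ := isCompact_Icc.exists_bound_of_continuousOn
    (p.derivative.continuous.continuousOn (s := Icc (0 : ℝ) 1))
  have hP0 : 0 ≤ P := (norm_nonneg _).trans (hP 0 h0)
  have hP'0 : 0 ≤ P' := (norm_nonneg _).trans (hP' 0 h0)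
  set C := P * Q * B + P' * B + 2 * (P * B) with hC
  have hC0 : 0 ≤ C := by positivity
  refine ⟨C / δ + 1, by positivity, fun τ hτ z w v hz hw hwB hvB => ?_⟩
  have hτ0 : 0 < τ := lt_of_lt_of_le (by positivity) hτ
  have hτC : C / (2 * τ) ≤ δ / 2 := by
    have h2 : C / δ ≤ τ := by linarith
    rw [div_le_iff₀ hδ] at h2
    rw [div_le_iff₀ (by positivity)]
    linarith
  have hτc : (τ : ℂ) ≠ 0 := by exact_mod_cast hτ0.ne'
  have hnorm : ∀ x : ℂ, ‖x / (2 * I * τ)‖ = ‖x‖ / (2 * τ) := by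
    intro x
    simp [abs_of_pos hτ0]
  have hpd : ∀ s, HasDerivWithinAt (fun s => ((p.eval s : ℝ) : ℂ))
      ((p.derivative.eval s : ℝ) : ℂ) (Icc 0 1) s := fun s =>
    ((p.hasDerivAt s).ofReal_comp).hasDerivWithinAt
  -- The correction `p w / (2iτ)` is of order `1/τ`. Its derivative contains `-p ρ w`, which cancels
  -- the drive `q w = (q / ρ) ρ w` up to the approximation error.
  have hZ : ∀ s ∈ Icc (0 : ℝ) 1,
      HasDerivWithinAt (fun s => z s + (p.eval s : ℝ) * w s / (2 * I * τ))
        (((q s / ρ s - p.eval s : ℝ) : ℂ) * (ρ s * w s) +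
          ((p.eval s : ℝ) * (q s * v s) + (p.derivative.eval s : ℝ) * w s) / (2 * I * τ))
        (Icc 0 1) s := by
    intro s hs
    refine ((hz s hs).add (((hpd s).mul (hw s hs)).div_const _)).congr_deriv ?_
    have : (ρ s : ℂ) ≠ 0 := by exact_mod_cast (hpos s hs).ne'
    have hI := I_ne_zero
    push_cast
    field_simp
    ring
  have hbound := (convex_Icc (0 : ℝ) 1).norm_image_sub_le_of_norm_hasDerivWithin_le hZ
    (C := ε * (R * B) + (P * Q * B + P' * B) / (2 * τ)) (fun s hs => by
      refine (norm_add_le _ _).trans (add_le_add ?_ ?_)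
      · rw [norm_mul, norm_mul, norm_real, norm_real]
        have h3 : ‖q s / ρ s - p.eval s‖ ≤ ε := by
          rw [Real.norm_eq_abs, abs_sub_comm]; exact (hp s hs).le
        exact mul_le_mul h3 (mul_le_mul (hR s hs) (hwB s hs) (norm_nonneg _) hR0)
          (by positivity) hε0.le
      · rw [hnorm]
        gcongr
        refine (norm_add_le _ _).trans (add_le_add ?_ ?_)
        · rw [norm_mul, norm_mul, norm_real, norm_real, mul_assoc]
          exact mul_le_mul (hP s hs) (mul_le_mul (hQ s hs) (hvB s hs) (norm_nonneg _) hQ0)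
            (by positivity) hP0
        · rw [norm_mul, norm_real]
          exact mul_le_mul (hP' s hs) (hwB s hs) (norm_nonneg _) hP'0) h0 h1
  have hend : ∀ s ∈ Icc (0 : ℝ) 1, ‖((p.eval s : ℝ) : ℂ) * w s / (2 * I * τ)‖
      ≤ P * B / (2 * τ) := by
    intro s hs
    rw [hnorm, norm_mul, norm_real]
    gcongr
    · exact hP s hs
    · exact hwB s hs
  have hsplit : z 1 - z 0 = (z 1 + (p.eval 1 : ℝ) * w 1 / (2 * I * τ)
      - (z 0 + (p.eval 0 : ℝ) * w 0 / (2 * I * τ)))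
      - (p.eval 1 : ℝ) * w 1 / (2 * I * τ) + (p.eval 0 : ℝ) * w 0 / (2 * I * τ) := by ring
  rw [hsplit]
  refine (norm_add_le _ _).trans ?_
  refine (add_le_add (norm_sub_le _ _) le_rfl).trans ?_
  refine (add_le_add (add_le_add hbound (hend 1 h1)) (hend 0 h0)).trans ?_
  have : C / (2 * τ) = (P * Q * B + P' * B) / (2 * τ) + P * B / (2 * τ) + P * B / (2 * τ) := by
    rw [hC]; ring
  norm_num
  linarith

/-! ### Norm conservation and existence for skew-adjoint linear equations. -/

open Set in
theorem norm_eq_of_re_inner_deriv_eq_zero {E : Type*} [NormedAddCommGroup E]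
    [InnerProductSpace ℂ E] [NormedSpace ℝ E] {a b : ℝ} {y y' : ℝ → E}
    (hy : ∀ s ∈ Icc a b, HasDerivWithinAt y (y' s) (Icc a b) s)
    (h : ∀ s ∈ Icc a b, (inner ℂ (y s) (y' s)).re = 0) {s : ℝ} (hs : s ∈ Icc a b) :
    ‖y s‖ = ‖y a‖ := by
  have h1 := eq_left_of_hasDerivWithinAt_zero (f := fun s => (inner ℂ (y s) (y s) : ℂ))
    (fun s hs => ((hy s hs).inner ℂ (hy s hs)).congr_deriv (by
      rw [← inner_conj_symm (y' s) (y s), Complex.add_conj, h s hs]; simp)) hs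
  simp only [inner_self_eq_norm_sq_to_K] at h1
  norm_cast at h1
  exact (sq_eq_sq₀ (norm_nonneg _) (norm_nonneg _)).1 (by exact_mod_cast h1)

/-- The radial map `y ↦ (1 + M²) / (1 + ‖y‖²) y`, bounded and Lipschitz, which fixes the sphere of
radius `M`. -/
noncomputable def radialMap {E : Type*} [NormedAddCommGroup E] [NormedSpace ℝ E] (M : ℝ)
    (y : E) : E :=
  ((1 + M ^ 2) / (1 + ‖y‖ ^ 2)) • y

section radialMap

variable {E : Type*} [NormedAddCommGroup E] [NormedSpace ℝ E] (M : ℝ)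

theorem radialMap_of_norm_eq {y : E} (hy : ‖y‖ = M) : radialMap M y = y := by
  rw [radialMap, hy, div_self (by positivity), one_smul]

theorem norm_radialMap_le (y : E) : ‖radialMap M y‖ ≤ 1 + M ^ 2 := by
  rw [radialMap, norm_smul, Real.norm_of_nonneg (by positivity), div_mul_eq_mul_div,
    div_le_iff₀ (by positivity)]
  gcongr
  nlinarith [sq_nonneg (‖y‖ - 1)]

theorem norm_radialMap_sub_le (y z : E) :
    ‖radialMap M y - radialMap M z‖ ≤ 3 * (1 + M ^ 2) * ‖y - z‖ := by
  have hy : 0 < 1 + ‖y‖ ^ 2 := by positivity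
  have hz : 0 < 1 + ‖z‖ ^ 2 := by positivity
  have h : radialMap M y - radialMap M z = ((1 + M ^ 2) / (1 + ‖y‖ ^ 2)) • (y - z)
      + ((1 + M ^ 2) * (‖z‖ - ‖y‖) * ((‖z‖ + ‖y‖) / ((1 + ‖y‖ ^ 2) * (1 + ‖z‖ ^ 2)))) • z := by
    simp only [radialMap, smul_sub]
    have : (1 + M ^ 2) * (‖z‖ - ‖y‖) * ((‖z‖ + ‖y‖) / ((1 + ‖y‖ ^ 2) * (1 + ‖z‖ ^ 2)))
        = (1 + M ^ 2) / (1 + ‖y‖ ^ 2) - (1 + M ^ 2) / (1 + ‖z‖ ^ 2) := by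
      field_simp
      ring
    rw [this, sub_smul]
    abel
  have hd : |‖z‖ - ‖y‖| ≤ ‖y - z‖ := by
    rw [abs_sub_comm]; exact abs_norm_sub_norm_le y z
  have h1 : (1 + M ^ 2) / (1 + ‖y‖ ^ 2) ≤ 1 + M ^ 2 :=
    div_le_self (by positivity) (by nlinarith [sq_nonneg ‖y‖])
  have h2 : (‖z‖ + ‖y‖) / ((1 + ‖y‖ ^ 2) * (1 + ‖z‖ ^ 2)) * ‖z‖ ≤ 2 := by
    rw [div_mul_eq_mul_div, div_le_iff₀ (by positivity)]
    nlinarith [sq_nonneg (‖z‖ - ‖y‖), sq_nonneg (‖y‖ * ‖z‖), sq_nonneg ‖y‖, sq_nonneg ‖z‖]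
  rw [h]
  refine (norm_add_le _ _).trans ?_
  rw [norm_smul, norm_smul, Real.norm_of_nonneg (by positivity : 0 ≤ (1 + M ^ 2) / (1 + ‖y‖ ^ 2)),
    norm_mul, norm_mul, Real.norm_of_nonneg (by positivity : 0 ≤ 1 + M ^ 2), Real.norm_eq_abs,
    Real.norm_of_nonneg (by positivity : 0 ≤ (‖z‖ + ‖y‖) / ((1 + ‖y‖ ^ 2) * (1 + ‖z‖ ^ 2))),
    mul_assoc ((1 + M ^ 2) * |‖z‖ - ‖y‖|)]
  calc _ ≤ (1 + M ^ 2) * ‖y - z‖ + (1 + M ^ 2) * ‖y - z‖ * 2 := by gcongr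
    _ = _ := by ring

end radialMap

open Set NNReal in
/-- A linear equation `y' = L(t) y` with continuous skew-adjoint coefficients has a solution on
every compact interval. -/
theorem exists_solution_of_skew {E : Type*} [NormedAddCommGroup E] [InnerProductSpace ℂ E]
    [NormedSpace ℝ E] [IsScalarTower ℝ ℂ E] [CompleteSpace E] {τ : ℝ} (hτ : 0 ≤ τ)
    {L : ℝ → E →L[ℂ] E} (hL : ContinuousOn L (Icc 0 τ))
    (hskew : ∀ t ∈ Icc 0 τ, ∀ y, (inner ℂ y (L t y)).re = 0) (y₀ : E) :
    ∃ y : ℝ → E, y 0 = y₀ ∧ ∀ t ∈ Icc 0 τ, HasDerivWithinAt y (L t (y t)) (Icc 0 τ) t := by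
  obtain ⟨C, hC⟩ := isCompact_Icc.exists_bound_of_continuousOn hL
  have hC0 : 0 ≤ C := (norm_nonneg _).trans (hC 0 (left_mem_Icc.2 hτ))
  set M := ‖y₀‖
  have hK : 0 ≤ C * (3 * (1 + M ^ 2)) := by positivity
  have hB : 0 ≤ C * (1 + M ^ 2) := by positivity
  -- The truncated field is bounded by `C * (1 + M ^ 2)` everywhere, so a ball of radius that times
  -- `τ` suffices for the whole interval.
  have hpl : IsPicardLindelof (fun t y => L t (radialMap M y)) (tmin := 0) (tmax := τ)
      ⟨0, left_mem_Icc.2 hτ⟩ y₀ ⟨C * (1 + M ^ 2) * τ, by positivity⟩ 0 ⟨_, hB⟩ ⟨_, hK⟩ := by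
    refine ⟨fun t ht => ?_, fun y _ => hL.clm_apply continuousOn_const, fun t ht y _ => ?_, ?_⟩
    · refine (LipschitzWith.of_dist_le_mul fun y z => ?_).lipschitzOnWith
      rw [dist_eq_norm, dist_eq_norm, ← map_sub]
      refine ((L t).le_opNorm _).trans ?_
      change _ ≤ C * (3 * (1 + M ^ 2)) * _
      rw [mul_assoc]
      exact mul_le_mul (hC t ht) (norm_radialMap_sub_le M y z) (norm_nonneg _) hC0
    · exact ((L t).le_opNorm _).trans
        (mul_le_mul (hC t ht) (norm_radialMap_le M y) (norm_nonneg _) hC0)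
    · simp [max_eq_left hτ]
      exact le_rfl
  obtain ⟨y, hy0, hy⟩ := hpl.exists_eq_forall_mem_Icc_hasDerivWithinAt₀
  refine ⟨y, hy0, fun t ht => ?_⟩
  -- The truncation multiplies by a real scalar, so the field stays skew and the norm stays `M`. On
  -- that sphere the truncation is the identity.
  have hnorm := norm_eq_of_re_inner_deriv_eq_zero hy (fun s hs => by
    rw [radialMap, ← algebraMap_smul ℂ, Complex.coe_algebraMap, map_smul, inner_smul_right,
      Complex.re_ofReal_mul, hskew s hs, mul_zero]) ht
  rw [show y 0 = y₀ from hy0] at hnorm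
  have := hy t ht
  rwa [radialMap_of_norm_eq M hnorm] at this

/-! ### The adiabatic theorem with a one-level coupling. -/

open Set Complex in
/-- The adiabatic theorem for a Hamiltonian `-τρ(s)S(s)` and a curve `Ω` of eigenvectors of `S` with
eigenvalue `N` that is parallel transported by `q(s)J`, if `J` lowers the eigenvalue by `2`. -/
theorem exists_phase_adiabatic {E : Type*} [NormedAddCommGroup E] [InnerProductSpace ℂ E]
    [NormedSpace ℝ E] [IsScalarTower ℝ ℂ E] {ρ q : ℝ → ℝ} (hρ : ContinuousOn ρ (Icc 0 1))
    (hq : ContinuousOn q (Icc 0 1)) (hpos : ∀ s ∈ Icc (0 : ℝ) 1, 0 < ρ s)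
    {S : ℝ → E →L[ℂ] E} (hS : ∀ s ∈ Icc (0 : ℝ) 1, ∀ x y, inner ℂ (S s x) y = inner ℂ x (S s y))
    {J : E →L[ℂ] E} (hJ : ∀ x y, inner ℂ (J x) y = -inner ℂ x (J y)) (N M : ℝ) :
    ∃ θ : ℝ → ℝ, ∀ δ : ℝ, 0 < δ → ∃ T : ℝ, 0 < T ∧ ∀ τ : ℝ, T ≤ τ → ∀ Ω φ : ℝ → E,
      (∀ s ∈ Icc (0 : ℝ) 1, HasDerivWithinAt Ω ((q s : ℂ) • J (Ω s)) (Icc 0 1) s) →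
      (∀ s ∈ Icc (0 : ℝ) 1, S s (Ω s) = (N : ℂ) • Ω s) →
      (∀ s ∈ Icc (0 : ℝ) 1, S s (J (Ω s)) = ((N - 2 : ℝ) : ℂ) • J (Ω s)) →
      (∀ s ∈ Icc (0 : ℝ) 1, HasDerivWithinAt φ ((I * τ * ρ s) • S s (φ s)) (Icc 0 1) s) →
      φ 0 = Ω 0 → ‖Ω 0‖ ≤ M → ‖φ 1 - exp (I * θ τ) • Ω 1‖ ≤ δ := by
  obtain ⟨R, hR0, hR⟩ := exists_hasDerivWithinAt_Icc zero_le_one hρ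
  -- The dynamical phase: `R 1` is the integral of `ρ`, so it does not depend on the state.
  refine ⟨fun τ => N * τ * R 1, fun δ hδ => ?_⟩
  obtain ⟨T, hT, h⟩ := exists_forall_norm_sub_le_of_oscillating hρ hq hpos
    (B := max (‖J‖ * M * M) (‖J‖ * (‖J‖ * M) * M)) (δ := δ ^ 2 / 2)
    (le_max_of_le_left (mul_assoc ‖J‖ M M ▸ mul_nonneg (norm_nonneg _) (mul_self_nonneg M)))
    (by positivity)
  refine ⟨T, hT, fun τ hτ Ω φ hΩ hSΩ hSJ hφ h0 hM => ?_⟩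
  have h1 : (1 : ℝ) ∈ Icc (0 : ℝ) 1 := by simp
  have hM0 : 0 ≤ M := (norm_nonneg _).trans hM
  have hnΩ : ∀ s ∈ Icc (0 : ℝ) 1, ‖Ω s‖ = ‖Ω 0‖ := fun s hs =>
    norm_eq_of_re_inner_deriv_eq_zero hΩ (fun s _ => by
      have h2 := congrArg re (hJ (Ω s) (Ω s))
      rw [← inner_conj_symm, conj_re, neg_re] at h2
      rw [inner_smul_right, re_ofReal_mul, show (inner ℂ (Ω s) (J (Ω s))).re = 0 by linarith,
        mul_zero]) hs
  have hnφ : ∀ s ∈ Icc (0 : ℝ) 1, ‖φ s‖ = ‖Ω 0‖ := fun s hs =>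
    (norm_eq_of_re_inner_deriv_eq_zero hφ (fun s hs => by
      have h2 := congrArg im (hS s hs (φ s) (φ s))
      rw [← inner_conj_symm, conj_im] at h2
      rw [inner_smul_right, show I * τ * ρ s = ((τ * ρ s : ℝ) : ℂ) * I by push_cast; ring,
        mul_assoc, re_ofReal_mul, I_mul_re, show (inner ℂ (φ s) (S s (φ s))).im = 0 by linarith]
      simp) hs).trans (by rw [h0])
  set e : ℝ → ℂ := fun s => exp (-(I * N * τ * R s)) with he
  have hen : ∀ s, ‖e s‖ = 1 := fun s => by
    change ‖exp (-(I * N * τ * R s))‖ = 1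
    rw [show -(I * N * τ * R s) = ((-(N * τ * R s) : ℝ) : ℂ) * I by push_cast; ring]
    exact norm_exp_ofReal_mul_I _
  have he' : ∀ s ∈ Icc (0 : ℝ) 1,
      HasDerivWithinAt e (e s * -(I * N * τ * ρ s)) (Icc 0 1) s := fun s hs =>
    (((hR s hs).ofReal_comp.const_mul _).neg).cexp
  have hJΩ : ∀ s ∈ Icc (0 : ℝ) 1,
      HasDerivWithinAt (fun s => J (Ω s)) ((q s : ℂ) • J (J (Ω s))) (Icc 0 1) s := fun s hs => by
    rw [← map_smul]
    exact (J.restrictScalars ℝ).hasFDerivAt.comp_hasDerivWithinAt s (hΩ s hs)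
  -- The factor `e` removes the dynamical phase of the level `N`. Since `J Ω` has eigenvalue `N -
  -- 2`, the second overlap retains the rate `-2iτρ`.
  have key := h τ hτ (fun s => e s * inner ℂ (Ω s) (φ s)) (fun s => e s * inner ℂ (J (Ω s)) (φ s))
    (fun s => e s * inner ℂ (J (J (Ω s))) (φ s))
    (fun s hs => ((he' s hs).mul ((hΩ s hs).inner ℂ (hφ s hs))).congr_deriv (by
      rw [inner_smul_right, ← hS s hs, hSΩ s hs, inner_smul_left, inner_smul_left]
      simp only [conj_ofReal]
      ring))
    (fun s hs => ((he' s hs).mul ((hJΩ s hs).inner ℂ (hφ s hs))).congr_deriv (by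
      rw [inner_smul_right, ← hS s hs, hSJ s hs, inner_smul_left, inner_smul_left]
      simp only [conj_ofReal]
      push_cast
      ring))
    (fun s hs => by
      rw [norm_mul, hen, one_mul]
      refine (norm_inner_le_norm _ _).trans (le_trans ?_ (le_max_left _ _))
      rw [hnφ s hs]
      refine mul_le_mul ((J.le_opNorm _).trans ?_) hM (norm_nonneg _) (by positivity)
      rw [hnΩ s hs]
      gcongr)
    (fun s hs => by
      rw [norm_mul, hen, one_mul]
      refine (norm_inner_le_norm _ _).trans (le_trans ?_ (le_max_right _ _))
      rw [hnφ s hs]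
      refine mul_le_mul ((J.le_opNorm _).trans ?_) hM (norm_nonneg _) (by positivity)
      refine mul_le_mul_of_nonneg_left ((J.le_opNorm _).trans ?_) (norm_nonneg _)
      rw [hnΩ s hs]
      gcongr)
  have hz0 : e 0 * inner ℂ (Ω 0) (φ 0) = ((‖Ω 0‖ ^ 2 : ℝ) : ℂ) := by
    rw [h0, he, inner_self_eq_norm_sq_to_K]
    simp [hR0]
  have hphase : inner ℂ (exp (I * (N * τ * R 1 : ℝ)) • Ω 1) (φ 1) = e 1 * inner ℂ (Ω 1) (φ 1) := by
    rw [inner_smul_left, ← exp_conj]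
    congr 2
    simp only [map_mul, conj_I, conj_ofReal]
    push_cast
    ring
  have hexp : ‖exp (I * (N * τ * R 1 : ℝ)) • Ω 1‖ = ‖Ω 0‖ := by
    rw [norm_smul, mul_comm I, norm_exp_ofReal_mul_I, one_mul, hnΩ 1 h1]
  -- Both vectors have norm `‖Ω 0‖`, so their distance is governed by the real part of the overlap;
  -- hence the tolerance `δ ^ 2 / 2` above.
  have hsq : ‖φ 1 - exp (I * (N * τ * R 1 : ℝ)) • Ω 1‖ ^ 2
      = 2 * (‖Ω 0‖ ^ 2 - (e 1 * inner ℂ (Ω 1) (φ 1)).re) := by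
    have := norm_sub_sq (𝕜 := ℂ) (exp (I * (N * τ * R 1 : ℝ)) • Ω 1) (φ 1)
    rw [norm_sub_rev, this, hphase, hexp, hnφ 1 h1]
    simp only [RCLike.re_to_complex]
    ring
  have hre : ‖Ω 0‖ ^ 2 - (e 1 * inner ℂ (Ω 1) (φ 1)).re ≤ δ ^ 2 / 2 := by
    refine le_trans ?_ key
    rw [hz0, norm_sub_rev]
    refine le_trans (le_of_eq ?_) (re_le_norm _)
    rw [sub_re, ofReal_re]
  exact (sq_le_sq₀ (norm_nonneg _) hδ.le).1 (by rw [hsq]; linarith)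

/-! ### Algebra of anticommuting pairs. -/

/-- Families `A`, `D` of involutions such that `A j` and `D j` anticommute, and any two members with
different indices, or of the same family, commute. -/
structure AnticommutingPairs {ι R : Type*} [Ring R] (A D : ι → R) : Prop where
  sq_left : ∀ j, A j * A j = 1
  sq_right : ∀ j, D j * D j = 1
  anti : ∀ j, A j * D j = -(D j * A j)
  comm_left : ∀ i j, Commute (A i) (A j)
  comm_right : ∀ i j, Commute (D i) (D j)
  comm : ∀ i j, i ≠ j → Commute (A i) (D j)

namespace AnticommutingPairs

section Ring

variable {ι R : Type*} [Ring R] {A D : ι → R}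

theorem map {R' F : Type*} [Ring R'] [FunLike F R R'] [RingHomClass F R R']
    (h : AnticommutingPairs A D) (f : F) :
    AnticommutingPairs (fun j => f (A j)) (fun j => f (D j)) where
  sq_left j := by rw [← map_mul, h.sq_left, map_one]
  sq_right j := by rw [← map_mul, h.sq_right, map_one]
  anti j := by rw [← map_mul, h.anti, map_neg, map_mul]
  comm_left i j := (h.comm_left i j).map f
  comm_right i j := (h.comm_right i j).map f
  comm i j hij := (h.comm i j hij).map f

variable (h : AnticommutingPairs A D)
include h

theorem rot_mul_self (j : ι) : D j * A j * (D j * A j) = -1 := by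
  rw [mul_assoc, ← mul_assoc (A j), h.anti, neg_mul, mul_assoc (D j) (A j) (A j), h.sq_left,
    mul_one, mul_neg, h.sq_right]

theorem rot_mul_left (j : ι) : D j * A j * A j = D j := by
  rw [mul_assoc, h.sq_left, mul_one]

theorem left_mul_rot (j : ι) : A j * (D j * A j) = -D j := by
  rw [← mul_assoc, h.anti, neg_mul, mul_assoc, h.sq_left, mul_one]

theorem rot_mul_right (j : ι) : D j * A j * D j = -A j := by
  rw [mul_assoc, h.anti, mul_neg, ← mul_assoc, h.sq_right, one_mul]

theorem right_mul_rot (j : ι) : D j * (D j * A j) = A j := by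
  rw [← mul_assoc, h.sq_right, one_mul]

theorem commute_left_rot {i j : ι} (hij : i ≠ j) : Commute (A i) (D j * A j) :=
  (h.comm i j hij).mul_right (h.comm_left i j)

theorem commute_right_rot {i j : ι} (hij : i ≠ j) : Commute (D i) (D j * A j) :=
  (h.comm_right i j).mul_right (h.comm j i hij.symm).symm

theorem commute_rot (i j : ι) : Commute (D i * A i) (D j * A j) := by
  by_cases hij : i = j
  · rw [hij]
  · exact (h.commute_right_rot hij).mul_left (h.commute_left_rot hij)

/-- In the commutator only equal indices contribute, and there `D A A - A D A = 2 D`. Together with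
`sum_rot_mul_sum_right`, this makes the commutator with the sum of flips an infinitesimal rotation
of a plane. -/
theorem sum_rot_mul_sum_left [Fintype ι] :
    (∑ j, D j * A j) * ∑ j, A j = (∑ j, A j) * (∑ j, D j * A j) + 2 * ∑ j, D j := by
  classical
  rw [Finset.sum_mul_sum, Finset.sum_comm, Finset.sum_mul_sum, Finset.mul_sum,
    ← Finset.sum_add_distrib]
  refine Finset.sum_congr rfl fun i _ => ?_
  rw [← sub_eq_iff_eq_add', ← Finset.sum_sub_distrib, Finset.sum_eq_single i]
  · rw [h.rot_mul_left, h.left_mul_rot, sub_neg_eq_add, two_mul]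
  · intro j _ hj
    rw [(h.commute_left_rot hj.symm).eq, sub_self]
  · simp

theorem sum_rot_mul_sum_right [Fintype ι] :
    (∑ j, D j * A j) * ∑ j, D j = (∑ j, D j) * (∑ j, D j * A j) - 2 * ∑ j, A j := by
  classical
  rw [Finset.sum_mul_sum, Finset.sum_comm, Finset.sum_mul_sum, Finset.mul_sum,
    ← Finset.sum_sub_distrib]
  refine Finset.sum_congr rfl fun i _ => ?_
  rw [eq_sub_iff_add_eq', ← eq_sub_iff_add_eq, ← Finset.sum_sub_distrib, Finset.sum_eq_single i]
  · rw [h.rot_mul_right, h.right_mul_rot, sub_neg_eq_add, two_mul]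
  · intro j _ hj
    rw [(h.commute_right_rot hj.symm).eq, sub_self]
  · simp

end Ring

/-! ### Spectrum of a sum of anticommuting pairs. -/

section Spectrum

variable {ι K V : Type*} [Field K] [AddCommGroup V] [Module K V] {A D : ι → Module.End K V}
  (h : AnticommutingPairs A D) {a b r : K} (hr : a ^ 2 + b ^ 2 = r ^ 2)
include h

theorem commute_combination (a b : K) (i j : ι) :
    Commute (a • A i + b • D i) (a • A j + b • D j) := by
  by_cases hij : i = j
  · rw [hij]
  · exact (((h.comm_left i j).smul_left a).smul_right a |>.add_right
      (((h.comm i j hij).smul_left a).smul_right b)).add_left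
      ((((h.comm j i (Ne.symm hij)).symm.smul_left b).smul_right a).add_right
      (((h.comm_right i j).smul_left b).smul_right b))

include hr in
theorem combination_mul_self (j : ι) :
    (a • A j + b • D j) * (a • A j + b • D j) = (r ^ 2) • (1 : Module.End K V) := by
  simp only [add_mul, mul_add, smul_mul_smul_comm, h.sq_left, h.sq_right, h.anti, ← hr, add_smul,
    mul_comm b a, sq, smul_neg]
  abel

theorem rot_mul_combination (j : ι) :
    (a • A j + b • D j) * (D j * A j) = -((D j * A j) * (a • A j + b • D j)) := by
  simp only [add_mul, mul_add, smul_mul_assoc, mul_smul_comm, h.rot_mul_left, h.rot_mul_right,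
    h.left_mul_rot, h.right_mul_rot, smul_neg, neg_add, neg_neg]

theorem commute_combination_rot (a b : K) {i j : ι} (hij : i ≠ j) :
    Commute (a • A i + b • D i) (D j * A j) :=
  ((h.commute_left_rot hij).smul_left a).add_left ((h.commute_right_rot hij).smul_left b)

include hr in
/-- An eigenvector of an operator that commutes with the involutions can be chosen as a joint
eigenvector of all of them. -/
theorem exists_joint_eigenvector [CharZero K] {S : Module.End K V}
    (hS : ∀ j, Commute S (a • A j + b • D j)) {g : K} {v : V} (hv : v ≠ 0) (hSv : S v = g • v)
    (hr0 : r ≠ 0) (s : Finset ι) :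
    ∃ v : V, v ≠ 0 ∧ S v = g • v ∧
      ∀ j ∈ s, ∃ ε : ℤˣ, (a • A j + b • D j) v = (((ε : ℤ) : K) * r) • v := by
  classical
  induction s using Finset.induction_on with
  | empty => exact ⟨v, hv, hSv, by simp⟩
  | insert j s hj ih =>
    obtain ⟨v, hv, hSv, hs⟩ := ih
    have hsq : (a • A j + b • D j) ((a • A j + b • D j) v) = (r ^ 2) • v := by
      rw [← Module.End.mul_apply, h.combination_mul_self hr]; rfl
    -- For `c = ±r`, the operator squares to `c ^ 2`, so this vector is an eigenvector with
    -- eigenvalue `c` unless it vanishes. Commutation preserves all eigenvalue equations already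
    -- obtained.
    have key : ∀ c : K, (a • A j + b • D j) v + c • v ≠ 0 → ∀ ε : ℤˣ, c = ((ε : ℤ) : K) * r →
        ∃ v : V, v ≠ 0 ∧ S v = g • v ∧ ∀ i ∈ insert j s, ∃ ε : ℤˣ,
          (a • A i + b • D i) v = (((ε : ℤ) : K) * r) • v := by
      intro c hc ε hε
      have hcomm : ∀ (T : Module.End K V) (μ : K), Commute T (a • A j + b • D j) → T v = μ • v →
          T ((a • A j + b • D j) v + c • v) = μ • ((a • A j + b • D j) v + c • v) := by
        intro T μ hT hTv
        rw [map_add, map_smul, hTv, ← Module.End.mul_apply, hT.eq, Module.End.mul_apply, hTv,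
          map_smul, smul_add, smul_comm]
      refine ⟨_, hc, hcomm S g (hS j) hSv, fun i hi => ?_⟩
      rcases Finset.mem_insert.1 hi with rfl | hi
      · refine ⟨ε, ?_⟩
        have hcc : r ^ 2 = c * c := by
          rcases Int.units_eq_one_or ε with rfl | rfl <;> simp [hε] <;> ring
        rw [map_add, hsq, map_smul, ← hε, smul_add, smul_smul, hcc]
        abel
      · obtain ⟨ε', hε'⟩ := hs i hi
        exact ⟨ε', hcomm _ _ (h.commute_combination a b i j) hε'⟩
    -- Both candidates cannot vanish, since they differ by `2 r v`.
    by_cases hp : (a • A j + b • D j) v + r • v = 0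
    · refine key (-r) (fun hm => ?_) (-1) (by simp)
      have h2 : (2 * r) • v = 0 := by
        rw [← sub_eq_zero.2 (hp.trans hm.symm)]
        module
      rcases smul_eq_zero.1 h2 with h3 | h3
      · simp [hr0] at h3
      · exact hv h3
    · exact key r hp 1 (by simp)

-- On a joint eigenvector the sum is a sum of signs times `r`; `m` counts the minus signs.
include hr in
theorem exists_eigenvalue_eq [CharZero K] [Fintype ι] {g : K} {v : V} (hv : v ≠ 0)
    (hSv : (∑ j, (a • A j + b • D j)) v = g • v) (hr0 : r ≠ 0) :
    ∃ m : ℕ, g = (Fintype.card ι - 2 * m) * r := by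
  classical
  obtain ⟨v, hv, hSv, hs⟩ := h.exists_joint_eigenvector hr
    (fun j => Commute.sum_left _ _ _ fun i _ => h.commute_combination a b i j) hv hSv hr0
    Finset.univ
  choose ε hε using fun j => hs j (Finset.mem_univ j)
  refine ⟨(Finset.univ.filter fun j => ε j = -1).card, ?_⟩
  have h1 : (∑ j, (((ε j : ℤ) : K) * r)) • v = g • v := by
    rw [← hSv, LinearMap.sum_apply, Finset.sum_smul]
    exact Finset.sum_congr rfl fun j _ => (hε j).symm
  rw [← smul_left_injective K hv h1, ← Finset.sum_mul]
  congr 1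
  have h2 : ∀ j, ((ε j : ℤ) : K) = 1 - 2 * if ε j = -1 then 1 else 0 := by
    intro j
    rcases Int.units_eq_one_or (ε j) with h | h <;> rw [h] <;> norm_num
  simp only [h2, Finset.sum_sub_distrib, ← Finset.mul_sum, Finset.sum_boole]
  simp

theorem rot_apply_ne_zero (j : ι) {v : V} (hv : v ≠ 0) : (D j * A j) v ≠ 0 := by
  intro h0
  have h1 := congrArg (D j * A j) h0
  rw [map_zero, ← Module.End.mul_apply, h.rot_mul_self] at h1
  exact hv (neg_eq_zero.1 h1)

-- The flip `D i * A i` anticommutes with the `i`-th summand and commutes with the others, so it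
-- repairs one negative sign of a joint eigenvector at a time.
include hr in
theorem exists_ground_vector [CharZero K] [Nontrivial V] (hr0 : r ≠ 0) (s : Finset ι) :
    ∃ v : V, v ≠ 0 ∧ ∀ j ∈ s, (a • A j + b • D j) v = r • v := by
  classical
  obtain ⟨v₀, hv₀⟩ := exists_ne (0 : V)
  obtain ⟨v, hv, -, hs⟩ := h.exists_joint_eigenvector (S := 0) hr (fun j => Commute.zero_left _)
    (g := 0) hv₀ (by simp) hr0 s
  choose! ε hε using hs
  -- Here `t` collects the indices whose sign has already been made positive.
  suffices H : ∀ t ⊆ s, ∃ v : V, v ≠ 0 ∧ ∀ j ∈ s,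
      (a • A j + b • D j) v = ((((if j ∈ t then 1 else ε j) : ℤˣ) : ℤ) * r : K) • v by
    obtain ⟨w, hw, hws⟩ := H s subset_rfl
    exact ⟨w, hw, fun j hj => by simpa [hj] using hws j hj⟩
  intro t
  induction t using Finset.induction_on with
  | empty => exact fun _ => ⟨v, hv, fun j hj => by simpa using hε j hj⟩
  | insert i t hi ih =>
    intro ht
    obtain ⟨w, hw, hws⟩ := ih ((Finset.subset_insert _ _).trans ht)
    rcases Int.units_eq_one_or (ε i) with h1 | h1
    · refine ⟨w, hw, fun j hj => ?_⟩
      rw [hws j hj]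
      by_cases hji : j = i
      · simp [hji, hi, h1]
      · simp [hji]
    · refine ⟨_, h.rot_apply_ne_zero i hw, fun j hj => ?_⟩
      by_cases hji : j = i
      · subst hji
        rw [← Module.End.mul_apply, h.rot_mul_combination, LinearMap.neg_apply,
          Module.End.mul_apply, hws j hj, map_smul, ← neg_smul]
        simp [hi, h1]
      · rw [← Module.End.mul_apply, (h.commute_combination_rot a b hji).eq,
          Module.End.mul_apply, hws j hj, map_smul]
        simp [hji]

theorem sum_combination_apply_rot [Fintype ι] {v : V}
    (hv : ∀ j, (a • A j + b • D j) v = r • v) (i : ι) :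
    (∑ j, (a • A j + b • D j)) ((D i * A i) v)
      = ((Fintype.card ι - 2) * r) • (D i * A i) v := by
  classical
  have h1 : ∀ j, (a • A j + b • D j) ((D i * A i) v)
      = (r - if j = i then 2 * r else 0) • (D i * A i) v := by
    intro j
    by_cases hji : j = i
    · subst hji
      rw [← Module.End.mul_apply, h.rot_mul_combination, LinearMap.neg_apply,
        Module.End.mul_apply, hv, map_smul, ← neg_smul, if_pos rfl]
      congr 1
      ring
    · rw [← Module.End.mul_apply, (h.commute_combination_rot a b hji).eq,
        Module.End.mul_apply, hv, map_smul, if_neg hji, sub_zero]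
  rw [LinearMap.sum_apply, Finset.sum_congr rfl fun j _ => h1 j, ← Finset.sum_smul]
  congr 1
  simp
  ring

end Spectrum

end AnticommutingPairs

/-! ### Exponentials that rotate operators and vectors. -/

section ExpRotation

open NormedSpace

variable {𝔸 : Type*} [NormedRing 𝔸] [NormedAlgebra ℂ 𝔸] [CompleteSpace 𝔸]

theorem exp_smul_mul_exp_neg_smul (J : 𝔸) (x : ℂ) : exp (x • J) * exp ((-x) • J) = 1 := by
  let := NormedAlgebra.restrictScalars ℚ ℂ 𝔸
  rw [← NormedSpace.exp_add_of_commute ((Commute.refl J).smul_left _ |>.smul_right _), ← add_smul,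
    add_neg_cancel, zero_smul, exp_zero]

/-- Uniqueness for `f' = J f`: the product `exp (-xJ) f(x)` has derivative zero. Closed forms of
exponentials then follow by differentiation alone. -/
theorem eq_exp_smul_mul_of_hasDerivAt {J : 𝔸} {f : ℂ → 𝔸} (hf : ∀ x, HasDerivAt f (J * f x) x)
    (x : ℂ) : f x = exp (x • J) * f 0 := by
  have h1 : ∀ x, HasDerivAt (fun x : ℂ => exp ((-x) • J) * f x) 0 x := fun x => by
    have h2 := ((hasDerivAt_exp_smul_const J (-x)).scomp x (hasDerivAt_neg x)).mul (hf x)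
    refine h2.congr_deriv ?_
    simp only [Function.comp_apply]
    rw [neg_one_smul, neg_mul, mul_assoc, neg_add_cancel]
  have h3 := is_const_of_deriv_eq_zero (fun x => (h1 x).differentiableAt)
    (fun x => (h1 x).deriv) x 0
  simp only [neg_zero, zero_smul, exp_zero, one_mul] at h3
  rw [← h3, ← mul_assoc, exp_smul_mul_exp_neg_smul, one_mul]

theorem exp_smul_of_mul_self_eq_neg_one {J : 𝔸} (hJ : J * J = -1) (x : ℂ) :
    exp (x • J) = Complex.cos x • (1 : 𝔸) + Complex.sin x • J := by
  have h := eq_exp_smul_mul_of_hasDerivAt (J := J)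
    (f := fun x => Complex.cos x • (1 : 𝔸) + Complex.sin x • J) (fun x => by
      refine (((Complex.hasDerivAt_cos x).smul_const _).add
        ((Complex.hasDerivAt_sin x).smul_const _)).congr_deriv ?_
      simp only [mul_add, mul_smul_comm, mul_one, hJ]
      module) x
  simpa using h.symm

/-- If the commutator with `J` rotates the plane spanned by `G` and `F`, then so does conjugation by
the exponential of `J`. -/
theorem rotated_mul_exp_smul {G F J : 𝔸} (hG : J * G = G * J + 2 * F) (hF : J * F = F * J - 2 * G)
    (x : ℂ) :
    (Complex.cos x • G + Complex.sin x • F) * exp ((x / 2) • J) = exp ((x / 2) • J) * G := by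
  have h := eq_exp_smul_mul_of_hasDerivAt (J := J)
    (f := fun x => (Complex.cos (2 * x) • G + Complex.sin (2 * x) • F) * exp (x • J)) (fun x => by
      have h2 : HasDerivAt (fun x : ℂ => 2 * x) 2 x := by
        simpa using (hasDerivAt_id x).const_mul 2
      refine (((h2.ccos.smul_const _).add (h2.csin.smul_const _)).mul
        (hasDerivAt_exp_smul_const' J x)).congr_deriv ?_
      rw [← mul_assoc, ← mul_assoc, ← add_mul]
      congr 1
      simp only [mul_add, add_mul, mul_smul_comm, smul_mul_assoc, hG, hF, two_mul]
      module) (x / 2)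
  rw [mul_div_cancel₀ x (two_ne_zero)] at h
  simpa using h

end ExpRotation

section Transport

variable {E : Type*} [NormedAddCommGroup E] [NormedSpace ℂ E] {ι : Type*} {A D : ι → E →L[ℂ] E}

namespace AnticommutingPairs

theorem commute_left_exp (h : AnticommutingPairs A D) {j : ι} {s : Finset ι} (hj : j ∉ s) (x : ℂ) :
    Commute (A j) (NormedSpace.exp (x • ∑ i ∈ s, D i * A i)) := by
  let := NormedAlgebra.restrictScalars ℚ ℂ (E →L[ℂ] E)
  exact ((Commute.sum_right _ _ _ fun i hi =>
    h.commute_left_rot (ne_of_mem_of_not_mem hi hj).symm).smul_right x).exp_right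

/-- The new flip squares to `-1`, giving a factor `cos x + sin x D j A j`. Here `A j` commutes with
the remaining exponential and fixes `v`, so only `D j` remains. -/
theorem exp_insert_apply (h : AnticommutingPairs A D) [CompleteSpace E] [DecidableEq ι]
    {j : ι} {s : Finset ι} (hj : j ∉ s) (x : ℂ) {v : E}
    (hv : A j v = v) :
    NormedSpace.exp (x • ∑ i ∈ insert j s, D i * A i) v
      = (Complex.cos x) • NormedSpace.exp (x • ∑ i ∈ s, D i * A i) v
        + (Complex.sin x) • D j (NormedSpace.exp (x • ∑ i ∈ s, D i * A i) v) := by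
  let := NormedAlgebra.restrictScalars ℚ ℂ (E →L[ℂ] E)
  have h1 : A j (NormedSpace.exp (x • ∑ i ∈ s, D i * A i) v)
      = NormedSpace.exp (x • ∑ i ∈ s, D i * A i) v := by
    rw [← mul_apply_eq_comp, (h.commute_left_exp hj x).eq,
      mul_apply_eq_comp, hv]
  rw [Finset.sum_insert hj, smul_add, NormedSpace.exp_add_of_commute
    (((Commute.sum_right _ _ _ fun i _ => h.commute_rot j i).smul_left x).smul_right x),
    exp_smul_of_mul_self_eq_neg_one (h.rot_mul_self j), mul_apply_eq_comp,
    _root_.add_apply, _root_.smul_apply, _root_.smul_apply,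
    mul_apply_eq_comp, h1, one_apply_eq_self]

end AnticommutingPairs

end Transport

/-! ### Pauli operators on a qubit register. -/

namespace AdiabaticTeleportation

section Register

variable {ι : Type*} [Fintype ι] [DecidableEq ι]

theorem onQubit_mulVec (q : ι) (A : Matrix (Fin 2) (Fin 2) ℂ) (f : (ι → Fin 2) → ℂ)
    (x : ι → Fin 2) :
    (onQubit q A *ᵥ f) x = ∑ b, A (x q) b * f (Function.update x q b) := by
  have h : ∀ b, A (x q) b * f (Function.update x q b)
      = ∑ y, if y = Function.update x q b then A (x q) b * f y else 0 := by
    intro b; simp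
  simp only [h]
  rw [Finset.sum_comm, mulVec, dotProduct]
  refine Finset.sum_congr rfl fun y _ => ?_
  simp only [onQubit, of_apply, Function.eq_update_iff]
  by_cases hy : ∀ r, r ≠ q → x r = y r
  · rw [if_pos hy, Finset.sum_eq_single (y q)]
    · rw [if_pos ⟨rfl, fun r hr => (hy r hr).symm⟩]
    · exact fun b _ hb => if_neg fun hc => hb hc.1.symm
    · simp
  · rw [if_neg hy, zero_mul]
    exact (Finset.sum_eq_zero fun b _ => if_neg fun hc => hy fun r hr => (hc.2 r hr).symm).symm

theorem ext_of_mulVec_apply {M N : QOp ι} (h : ∀ f x, (M *ᵥ f) x = (N *ᵥ f) x) : M = N :=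
  Matrix.ext_of_mulVec_single fun _ => funext fun x => h _ x

theorem onQubit_mul_onQubit (q : ι) (A B : Matrix (Fin 2) (Fin 2) ℂ) :
    onQubit q A * onQubit q B = onQubit q (A * B) := by
  refine ext_of_mulVec_apply fun f x => ?_
  rw [← mulVec_mulVec, onQubit_mulVec, onQubit_mulVec]
  simp only [onQubit_mulVec, Function.update_self, Function.update_idem, mul_apply,
    Finset.mul_sum, Finset.sum_mul, mul_assoc]
  exact Finset.sum_comm

theorem commute_onQubit {p q : ι} (hpq : p ≠ q) (A B : Matrix (Fin 2) (Fin 2) ℂ) :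
    Commute (onQubit p A) (onQubit q B) := by
  refine ext_of_mulVec_apply fun f x => ?_
  rw [← mulVec_mulVec, ← mulVec_mulVec, onQubit_mulVec, onQubit_mulVec]
  simp only [onQubit_mulVec, Function.update_of_ne hpq, Function.update_of_ne hpq.symm,
    Finset.mul_sum]
  rw [Finset.sum_comm]
  refine Finset.sum_congr rfl fun b _ => Finset.sum_congr rfl fun c _ => ?_
  rw [Function.update_comm hpq]
  ring

theorem onQubit_one (q : ι) : onQubit q (1 : Matrix (Fin 2) (Fin 2) ℂ) = 1 := by
  refine ext_of_mulVec_apply fun f x => ?_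
  simp [onQubit_mulVec, one_apply]

theorem onQubit_neg (q : ι) (A : Matrix (Fin 2) (Fin 2) ℂ) : onQubit q (-A) = -onQubit q A := by
  refine ext_of_mulVec_apply fun f x => ?_
  simp [onQubit_mulVec, neg_mulVec]

theorem conjTranspose_onQubit (q : ι) (A : Matrix (Fin 2) (Fin 2) ℂ) :
    (onQubit q A)ᴴ = onQubit q Aᴴ := by
  ext x y
  simp only [onQubit, conjTranspose_apply, of_apply, eq_comm (a := y _)]
  split_ifs <;> simp

theorem onQubit_pauliX_mul_self (q : ι) : onQubit q pauliX * onQubit q pauliX = 1 := by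
  rw [onQubit_mul_onQubit, ← onQubit_one q]
  congr 1
  ext i j
  fin_cases i <;> fin_cases j <;> simp [pauliX]

theorem onQubit_pauliZ_mul_self (q : ι) : onQubit q pauliZ * onQubit q pauliZ = 1 := by
  rw [onQubit_mul_onQubit, ← onQubit_one q]
  congr 1
  ext i j
  fin_cases i <;> fin_cases j <;> simp [pauliZ]

theorem onQubit_pauliX_mul_pauliZ (q : ι) :
    onQubit q pauliX * onQubit q pauliZ = -(onQubit q pauliZ * onQubit q pauliX) := by
  rw [onQubit_mul_onQubit, onQubit_mul_onQubit, ← onQubit_neg]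
  congr 1
  ext i j
  fin_cases i <;> fin_cases j <;> simp [pauliX, pauliZ]

theorem onQubit_pauliZ_mul_pauliX (q : ι) :
    onQubit q pauliZ * onQubit q pauliX = -(onQubit q pauliX * onQubit q pauliZ) := by
  rw [onQubit_pauliX_mul_pauliZ, neg_neg]

theorem commute_onQubit_same (p q : ι) (A : Matrix (Fin 2) (Fin 2) ℂ) :
    Commute (onQubit p A) (onQubit q A) := by
  by_cases h : p = q
  · rw [h]
  · exact commute_onQubit h A A

theorem conjTranspose_onQubit_pauliX (q : ι) : (onQubit q pauliX)ᴴ = onQubit q pauliX := by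
  rw [conjTranspose_onQubit]
  congr 1
  ext i j
  fin_cases i <;> fin_cases j <;> simp [pauliX]

theorem conjTranspose_onQubit_pauliZ (q : ι) : (onQubit q pauliZ)ᴴ = onQubit q pauliZ := by
  rw [conjTranspose_onQubit]
  congr 1
  ext i j
  fin_cases i <;> fin_cases j <;> simp [pauliZ]

theorem onQubit_pauliX_mulVec (q : ι) (f : (ι → Fin 2) → ℂ) (x : ι → Fin 2) :
    (onQubit q pauliX *ᵥ f) x = f (Function.update x q (x q + 1)) := by
  rw [onQubit_mulVec]
  have h : ∀ a : Fin 2, a = 0 ∨ a = 1 := by decide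
  rcases h (x q) with h | h <;> simp [pauliX, h]

/-- The sign `(-1) ^ a` of a bit. -/
noncomputable def bitSign (a : Fin 2) : ℂ := if a = 0 then 1 else -1

theorem onQubit_pauliZ_mulVec (q : ι) (f : (ι → Fin 2) → ℂ) (x : ι → Fin 2) :
    (onQubit q pauliZ *ᵥ f) x = bitSign (x q) * f x := by
  rw [onQubit_mulVec]
  have h : ∀ a : Fin 2, a = 0 ∨ a = 1 := by decide
  rcases h (x q) with h | h <;>
    rw [show f x = f (Function.update x q (x q)) by rw [Function.update_eq_self], h] <;>
    simp [pauliZ, bitSign]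

end Register

/-! ### The gate on the receiver's qubits. -/

section Gate

variable {n : ℕ}

/-- The basis state `x` with the receiver's bits replaced by `b`. -/
def setReceiver (x : Qubits n → Fin 2) (b : Fin n → Fin 2) : Qubits n → Fin 2 :=
  fun q => if q.2 = 2 then b q.1 else x q

theorem receiverGate_mulVec (U : QOp (Fin n)) (f : (Qubits n → Fin 2) → ℂ) (x : Qubits n → Fin 2) :
    (receiverGate U *ᵥ f) x = ∑ b, U (fun k => x (k, 2)) b * f (setReceiver x b) := by
  have h : ∀ b, U (fun k => x (k, 2)) b * f (setReceiver x b)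
      = ∑ y, if y = setReceiver x b then U (fun k => x (k, 2)) b * f y else 0 := by
    intro b; simp
  simp only [h]
  rw [Finset.sum_comm, mulVec, dotProduct]
  refine Finset.sum_congr rfl fun y _ => ?_
  have hy : ∀ b, y = setReceiver x b ↔
      b = (fun k => y (k, 2)) ∧ ∀ k : Fin n, x (k, 0) = y (k, 0) ∧ x (k, 1) = y (k, 1) := by
    intro b
    constructor
    · rintro rfl
      exact ⟨by ext k; simp [setReceiver], fun k => by simp [setReceiver]⟩
    · rintro ⟨rfl, hk⟩
      ext ⟨k, i⟩
      fin_cases i <;> simp [setReceiver, hk k]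
  simp only [hy, receiverGate, of_apply]
  split_ifs with hc <;> simp [hc]

theorem receiverGate_mul (U V : QOp (Fin n)) :
    receiverGate U * receiverGate V = receiverGate (U * V) := by
  refine ext_of_mulVec_apply fun f x => ?_
  rw [← mulVec_mulVec, receiverGate_mulVec, receiverGate_mulVec]
  have h : ∀ b c, setReceiver (setReceiver x b) c = setReceiver x c := by
    intro b c; ext q; simp only [setReceiver]; split_ifs <;> rfl
  have h' : ∀ b, (fun k => setReceiver x b (k, 2)) = b := by
    intro b; ext k; simp [setReceiver]
  simp only [receiverGate_mulVec, h, h', mul_apply, Finset.mul_sum, Finset.sum_mul, mul_assoc]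
  exact Finset.sum_comm

theorem receiverGate_one : receiverGate (1 : QOp (Fin n)) = 1 := by
  refine ext_of_mulVec_apply fun f x => ?_
  have h : setReceiver x (fun k => x (k, 2)) = x := by
    ext ⟨k, i⟩; simp only [setReceiver]; split_ifs with h
    · rw [← h]
    · rfl
  simp [receiverGate_mulVec, one_apply, h]

theorem conjTranspose_receiverGate (U : QOp (Fin n)) : (receiverGate U)ᴴ = receiverGate Uᴴ := by
  ext x y
  simp only [receiverGate, conjTranspose_apply, of_apply, eq_comm (a := y _)]
  split_ifs <;> simp

theorem receiverGate_mem_unitary {U : QOp (Fin n)} (hU : U ∈ unitaryGroup (Fin n → Fin 2) ℂ) :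
    receiverGate U ∈ unitary (QOp (Qubits n)) := by
  rw [Unitary.mem_iff, star_eq_conjTranspose, conjTranspose_receiverGate, receiverGate_mul,
    receiverGate_mul, ← star_eq_conjTranspose, (Unitary.mem_iff.1 hU).1, (Unitary.mem_iff.1 hU).2,
    receiverGate_one]
  exact ⟨rfl, rfl⟩

/-- The Bell pairs of the output avoid the receiver's qubits, so the gate reaches only the
teleported state. -/
theorem act_receiverGate_outputState (U : QOp (Fin n)) (ψ : QState (Fin n)) :
    act (receiverGate U) (outputState ψ) = outputState (act U ψ) := by
  ext x
  change (receiverGate U *ᵥ _) x = _ * (U *ᵥ _) _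
  rw [receiverGate_mulVec, mulVec, dotProduct, Finset.mul_sum]
  refine Finset.sum_congr rfl fun b _ => ?_
  simp [outputState, setReceiver]
  ring

end Gate

/-! ### The Hamiltonian as a sum of anticommuting pairs, and its parities. -/

section Family

variable {n : ℕ}

/-- The terms of the initial Hamiltonians: `1XX` for `(k, false)` and `1ZZ` for `(k, true)`. -/
noncomputable def initialTerm (j : Fin n × Bool) : QOp (Qubits n) :=
  bif j.2 then onQubit (j.1, 1) pauliZ * onQubit (j.1, 2) pauliZ
  else onQubit (j.1, 1) pauliX * onQubit (j.1, 2) pauliX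

/-- The terms of the final Hamiltonians: `ZZ1` for `(k, false)` and `XX1` for `(k, true)`. -/
noncomputable def finalTerm (j : Fin n × Bool) : QOp (Qubits n) :=
  bif j.2 then onQubit (j.1, 0) pauliX * onQubit (j.1, 1) pauliX
  else onQubit (j.1, 0) pauliZ * onQubit (j.1, 1) pauliZ

theorem Hmult_eq (ω ħ : ℝ) (ηi ηf : ℝ → ℝ) (s : ℝ) :
    Hmult n ω ħ ηi ηf s = (-(ω * ħ : ℂ)) •
      ∑ j, ((ηi s : ℂ) • initialTerm j + (ηf s : ℂ) • finalTerm j) := by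
  rw [Fintype.sum_prod_type, Finset.smul_sum, Hmult]
  refine Finset.sum_congr rfl fun k _ => ?_
  simp only [sectorH, sectorHi, sectorHf, Fintype.sum_bool, initialTerm, finalTerm, cond_true,
    cond_false]
  module

theorem commute_mul_mul {R : Type*} [Monoid R] {a b c d : R} (hac : Commute a c) (had : Commute a d)
    (hbc : Commute b c) (hbd : Commute b d) : Commute (a * b) (c * d) :=
  (hac.mul_right had).mul_left (hbc.mul_right hbd)

/-- The two sign changes cancel; this is why XX and ZZ on the same two qubits commute. -/
theorem commute_mul_mul_of_anti {R : Type*} [Ring R] {a b c d : R} (hac : a * c = -(c * a))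
    (had : Commute a d) (hbc : Commute b c) (hbd : b * d = -(d * b)) :
    Commute (a * b) (c * d) := by
  calc a * b * (c * d) = a * (b * c) * d := by noncomm_ring
    _ = a * c * (b * d) := by rw [hbc.eq]; noncomm_ring
    _ = c * (a * d) * b := by rw [hac, hbd]; noncomm_ring
    _ = c * d * (a * b) := by rw [had.eq]; noncomm_ring

theorem conjTranspose_initialTerm (j : Fin n × Bool) : (initialTerm j)ᴴ = initialTerm j := by
  obtain ⟨k, b | b⟩ := j
  · simp only [initialTerm, cond_false, conjTranspose_mul, conjTranspose_onQubit_pauliX]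
    exact commute_onQubit_same _ _ _
  · simp only [initialTerm, cond_true, conjTranspose_mul, conjTranspose_onQubit_pauliZ]
    exact commute_onQubit_same _ _ _

theorem conjTranspose_finalTerm (j : Fin n × Bool) : (finalTerm j)ᴴ = finalTerm j := by
  obtain ⟨k, b | b⟩ := j
  · simp only [finalTerm, cond_false, conjTranspose_mul, conjTranspose_onQubit_pauliZ]
    exact commute_onQubit_same _ _ _
  · simp only [finalTerm, cond_true, conjTranspose_mul, conjTranspose_onQubit_pauliX]
    exact commute_onQubit_same _ _ _

theorem commute_of_sector_ne {k l : Fin n} (hkl : k ≠ l) (a b c d : Fin 3)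
    (A B C D : Matrix (Fin 2) (Fin 2) ℂ) :
    Commute (onQubit (k, a) A * onQubit (k, b) B) (onQubit (l, c) C * onQubit (l, d) D) := by
  refine commute_mul_mul ?_ ?_ ?_ ?_ <;> exact commute_onQubit (by simp [hkl]) _ _

theorem mul_mul_self_of_commute {R : Type*} [Ring R] {a b : R} (hab : Commute a b) (ha : a * a = 1)
    (hb : b * b = 1) : a * b * (a * b) = 1 := by
  rw [hab.symm.mul_mul_mul_comm, ha, hb, one_mul]

/-- The labels of the two families are crossed: paired terms carry different Pauli matrices and
overlap only in the middle qubit, hence anticommute. Unpaired initial and final terms of a sector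
carry the same Pauli matrix, hence commute. -/
theorem anticommutingPairs_terms :
    AnticommutingPairs (initialTerm (n := n)) (finalTerm (n := n)) where
  sq_left := by
    rintro ⟨k, _ | _⟩ <;> refine mul_mul_self_of_commute (commute_onQubit_same _ _ _) ?_ ?_ <;>
      simp only [onQubit_pauliX_mul_self, onQubit_pauliZ_mul_self]
  sq_right := by
    rintro ⟨k, _ | _⟩ <;> refine mul_mul_self_of_commute (commute_onQubit_same _ _ _) ?_ ?_ <;>
      simp only [onQubit_pauliX_mul_self, onQubit_pauliZ_mul_self]
  anti := by
    have key : ∀ {P Q : Matrix (Fin 2) (Fin 2) ℂ} (k : Fin n),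
        onQubit ((k, 1) : Qubits n) P * onQubit (k, 1) Q
          = -(onQubit (k, 1) Q * onQubit (k, 1) P) →
        onQubit ((k, 1) : Qubits n) P * onQubit (k, 2) P * (onQubit (k, 0) Q * onQubit (k, 1) Q)
          = -(onQubit (k, 0) Q * onQubit (k, 1) Q * (onQubit (k, 1) P * onQubit (k, 2) P)) := by
      intro P Q k h
      have h1 := commute_onQubit (show ((k, 2) : Qubits n) ≠ (k, 0) by simp) P Q
      have h2 := commute_onQubit (show ((k, 2) : Qubits n) ≠ (k, 1) by simp) P Q
      have h3 := commute_onQubit (show ((k, 1) : Qubits n) ≠ (k, 0) by simp) P Q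
      rw [mul_assoc, (h1.mul_right h2).eq, ← mul_assoc, ← mul_assoc (onQubit (k, 1) P), h3.eq,
        mul_assoc (onQubit (k, 0) Q), h]
      noncomm_ring
    rintro ⟨k, _ | _⟩
    · exact key k (onQubit_pauliX_mul_pauliZ _)
    · exact key k (onQubit_pauliZ_mul_pauliX _)
  comm_left := by
    rintro ⟨k, b⟩ ⟨l, c⟩
    by_cases hkl : k = l
    · subst hkl
      cases b <;> cases c
      · exact Commute.refl _
      · exact commute_mul_mul_of_anti (onQubit_pauliX_mul_pauliZ _)
          (commute_onQubit (by simp) _ _) (commute_onQubit (by simp) _ _)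
          (onQubit_pauliX_mul_pauliZ _)
      · exact commute_mul_mul_of_anti (onQubit_pauliZ_mul_pauliX _)
          (commute_onQubit (by simp) _ _) (commute_onQubit (by simp) _ _)
          (onQubit_pauliZ_mul_pauliX _)
      · exact Commute.refl _
    · cases b <;> cases c <;> exact commute_of_sector_ne hkl _ _ _ _ _ _ _ _
  comm_right := by
    rintro ⟨k, b⟩ ⟨l, c⟩
    by_cases hkl : k = l
    · subst hkl
      cases b <;> cases c
      · exact Commute.refl _
      · exact commute_mul_mul_of_anti (onQubit_pauliZ_mul_pauliX _)
          (commute_onQubit (by simp) _ _) (commute_onQubit (by simp) _ _)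
          (onQubit_pauliZ_mul_pauliX _)
      · exact commute_mul_mul_of_anti (onQubit_pauliX_mul_pauliZ _)
          (commute_onQubit (by simp) _ _) (commute_onQubit (by simp) _ _)
          (onQubit_pauliX_mul_pauliZ _)
      · exact Commute.refl _
    · cases b <;> cases c <;> exact commute_of_sector_ne hkl _ _ _ _ _ _ _ _
  comm := by
    rintro ⟨k, b⟩ ⟨l, c⟩ hne
    by_cases hkl : k = l
    · subst hkl
      cases b <;> cases c
      · exact absurd rfl hne
      · exact commute_mul_mul (commute_onQubit_same _ _ _) (commute_onQubit_same _ _ _)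
          (commute_onQubit_same _ _ _) (commute_onQubit_same _ _ _)
      · exact commute_mul_mul (commute_onQubit_same _ _ _) (commute_onQubit_same _ _ _)
          (commute_onQubit_same _ _ _) (commute_onQubit_same _ _ _)
      · exact absurd rfl hne
    · cases b <;> cases c <;> exact commute_of_sector_ne hkl _ _ _ _ _ _ _ _

/-- A two-qubit term meets the parity of its own sector in exactly its two qubits, where `h`
applies; the third factor acts elsewhere. -/
theorem commute_pair_parity {P Q : Matrix (Fin 2) (Fin 2) ℂ}
    (h : ∀ p q : Qubits n, p ≠ q →
      Commute (onQubit p P * onQubit q P) (onQubit p Q * onQubit q Q)) (k l : Fin n) :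
    Commute (onQubit (k, 1) P * onQubit (k, 2) P)
        (onQubit (l, 0) Q * onQubit (l, 1) Q * onQubit (l, 2) Q : QOp (Qubits n)) ∧
      Commute (onQubit (k, 0) P * onQubit (k, 1) P)
        (onQubit (l, 0) Q * onQubit (l, 1) Q * onQubit (l, 2) Q : QOp (Qubits n)) := by
  by_cases hkl : k = l
  · subst hkl
    have h1 : ∀ {p q r : Qubits n}, p ≠ r → q ≠ r →
        Commute (onQubit p P * onQubit q P) (onQubit r Q) := fun hp hq =>
      (commute_onQubit hp _ _).mul_left (commute_onQubit hq _ _)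
    refine ⟨?_, (h _ _ (by simp)).mul_right (h1 (by simp) (by simp))⟩
    rw [mul_assoc]
    exact (h1 (by simp) (by simp)).mul_right (h _ _ (by simp))
  · have h1 : ∀ {p : Qubits n} (a : Fin 3), p.1 = k →
        Commute (onQubit p P) (onQubit (l, a) Q) := fun a hp =>
      commute_onQubit (fun hc => hkl (hp.symm.trans (congrArg Prod.fst hc))) _ _
    constructor <;>
      exact (((h1 0 rfl).mul_right (h1 1 rfl)).mul_right (h1 2 rfl)).mul_left
        (((h1 0 rfl).mul_right (h1 1 rfl)).mul_right (h1 2 rfl))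

theorem commute_initialTerm_finalTerm_parity (j : Fin n × Bool) (l : Fin n) :
    (Commute (initialTerm j) (parityZ l) ∧ Commute (finalTerm j) (parityZ l)) ∧
      Commute (initialTerm j) (parityX l) ∧ Commute (finalTerm j) (parityX l) := by
  have hX := commute_pair_parity (n := n) (P := pauliX) (Q := pauliX) fun p q _ => Commute.refl _
  have hZ := commute_pair_parity (n := n) (P := pauliZ) (Q := pauliZ) fun p q _ => Commute.refl _
  have hXZ := commute_pair_parity (n := n) (P := pauliX) (Q := pauliZ) fun p q h =>
    commute_mul_mul_of_anti (onQubit_pauliX_mul_pauliZ _) (commute_onQubit h _ _)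
      (commute_onQubit h.symm _ _) (onQubit_pauliX_mul_pauliZ _)
  have hZX := commute_pair_parity (n := n) (P := pauliZ) (Q := pauliX) fun p q h =>
    commute_mul_mul_of_anti (onQubit_pauliZ_mul_pauliX _) (commute_onQubit h _ _)
      (commute_onQubit h.symm _ _) (onQubit_pauliZ_mul_pauliX _)
  obtain ⟨k, _ | _⟩ := j
  · exact ⟨⟨(hXZ k l).1, (hZ k l).2⟩, (hX k l).1, (hZX k l).2⟩
  · exact ⟨⟨(hZ k l).1, (hXZ k l).2⟩, (hZX k l).1, (hX k l).2⟩

theorem commute_Hmult_parity (ω ħ : ℝ) (ηi ηf : ℝ → ℝ) (s : ℝ) (k : Fin n) :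
    Commute (Hmult n ω ħ ηi ηf s) (parityZ k) ∧ Commute (Hmult n ω ħ ηi ηf s) (parityX k) := by
  rw [Hmult_eq]
  constructor <;> refine (Commute.sum_left _ _ _ fun j _ => ?_).smul_left _
  · obtain ⟨⟨h1, h2⟩, -⟩ := commute_initialTerm_finalTerm_parity j k
    exact (h1.smul_left _).add_left (h2.smul_left _)
  · obtain ⟨-, h1, h2⟩ := commute_initialTerm_finalTerm_parity j k
    exact (h1.smul_left _).add_left (h2.smul_left _)

end Family

/-! ### Bell states and teleportation of one sector. -/

section Endpoints

variable {n : ℕ}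

/-- The state in which the sectors of `s` have been teleported and the others have not. -/
noncomputable def partialState (s : Finset (Fin n)) (ψ : QState (Fin n)) : QState (Qubits n) :=
  WithLp.toLp 2 fun x => ψ (fun k => if k ∈ s then x (k, 2) else x (k, 0)) *
    ∏ k : Fin n, if k ∈ s then bell (x (k, 0)) (x (k, 1)) else bell (x (k, 1)) (x (k, 2))

theorem partialState_empty (ψ : QState (Fin n)) : partialState ∅ ψ = inputState ψ := by
  simp [partialState, inputState]

theorem partialState_univ (ψ : QState (Fin n)) : partialState Finset.univ ψ = outputState ψ := by
  simp [partialState, outputState, mul_comm]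

theorem pauliX_pair_mulVec {p q : Qubits n} (hpq : p ≠ q) (f : (Qubits n → Fin 2) → ℂ)
    (x : Qubits n → Fin 2) :
    ((onQubit p pauliX * onQubit q pauliX) *ᵥ f) x =
      f (Function.update (Function.update x p (x p + 1)) q (x q + 1)) := by
  rw [← mulVec_mulVec, onQubit_pauliX_mulVec, onQubit_pauliX_mulVec,
    Function.update_of_ne hpq.symm]

theorem pauliZ_pair_mulVec (p q : Qubits n) (f : (Qubits n → Fin 2) → ℂ) (x : Qubits n → Fin 2) :
    ((onQubit p pauliZ * onQubit q pauliZ) *ᵥ f) x = bitSign (x p) * bitSign (x q) * f x := by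
  rw [← mulVec_mulVec, onQubit_pauliZ_mulVec, onQubit_pauliZ_mulVec, mul_assoc]

theorem bell_add_one (a b : Fin 2) : bell (a + 1) (b + 1) = bell a b := by
  simp [bell]

theorem bitSign_mul_self (a : Fin 2) : bitSign a * bitSign a = 1 := by
  unfold bitSign; split_ifs <;> norm_num

theorem bitSign_mul_of_ne {a b : Fin 2} (h : a ≠ b) : bitSign a * bitSign b = -1 := by
  revert a b
  have h : ∀ a : Fin 2, a = 0 ∨ a = 1 := by decide
  intro a b hab
  rcases h a with rfl | rfl <;> rcases h b with rfl | rfl <;> simp_all [bitSign]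

theorem act_initialTerm_inputState (j : Fin n × Bool) (ψ : QState (Fin n)) :
    act (initialTerm j) (inputState ψ) = inputState ψ := by
  obtain ⟨k, _ | _⟩ := j <;> ext x
  · change ((onQubit _ pauliX * onQubit _ pauliX) *ᵥ _) x = _
    rw [pauliX_pair_mulVec (by simp)]
    simp only [inputState]
    refine congrArg₂ (fun a b : ℂ => a * b) ?_ (Finset.prod_congr rfl fun l _ => ?_)
    · exact congrArg ψ.ofLp (funext fun l => by simp)
    by_cases hl : l = k
    · subst hl; simp [bell_add_one]
    · simp [hl]
  · change ((onQubit _ pauliZ * onQubit _ pauliZ) *ᵥ _) x = _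
    rw [pauliZ_pair_mulVec]
    by_cases hx : x (k, 1) = x (k, 2)
    · simp [hx, bitSign_mul_self]
    · have : ∏ l : Fin n, bell (x (l, 1)) (x (l, 2)) = 0 :=
        Finset.prod_eq_zero (Finset.mem_univ k) (by simp [bell, hx])
      simp [inputState, this]

/-- Exactly one of `x`, `y` has equal bits on the old Bell pair `(k, 1)`, `(k, 2)`. The surviving
amplitude reads its input bit from `(k, 0)`, where it equals the receiver's bit `x (k, 2)`. -/
theorem partialState_add_flip {s : Finset (Fin n)} {k : Fin n} (hk : k ∉ s) (ψ : QState (Fin n))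
    {x y : Qubits n → Fin 2} (hx : x (k, 0) = x (k, 1)) (hy : ∀ l ≠ k, ∀ i, y (l, i) = x (l, i))
    (hy0 : y (k, 0) = x (k, 0) + 1) (hy1 : y (k, 1) = x (k, 1) + 1) (hy2 : y (k, 2) = x (k, 2)) :
    partialState s ψ x + partialState s ψ y = partialState (insert k s) ψ x := by
  have hflip : ∀ a b : Fin 2, a ≠ b → a + 1 = b := by decide
  have hne : ∀ a : Fin 2, a + 1 ≠ a := by decide
  have e1 : ∏ l ∈ Finset.univ.erase k,
        (if l ∈ s then bell (y (l, 0)) (y (l, 1)) else bell (y (l, 1)) (y (l, 2)))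
      = ∏ l ∈ Finset.univ.erase k,
        (if l ∈ s then bell (x (l, 0)) (x (l, 1)) else bell (x (l, 1)) (x (l, 2))) :=
    Finset.prod_congr rfl fun l hl => by simp only [hy l (Finset.ne_of_mem_erase hl)]
  have e2 : ∏ l ∈ Finset.univ.erase k,
        (if l ∈ insert k s then bell (x (l, 0)) (x (l, 1)) else bell (x (l, 1)) (x (l, 2)))
      = ∏ l ∈ Finset.univ.erase k,
        (if l ∈ s then bell (x (l, 0)) (x (l, 1)) else bell (x (l, 1)) (x (l, 2))) :=
    Finset.prod_congr rfl fun l hl => by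
      simp only [Finset.mem_insert, Finset.ne_of_mem_erase hl, false_or]
  simp only [partialState, ← Finset.mul_prod_erase _ _ (Finset.mem_univ k), hk, if_false,
    Finset.mem_insert_self, if_true, hx]
  rw [e1, e2, hy1, hy2]
  by_cases h2 : x (k, 1) = x (k, 2)
  · have e3 : (fun l => if l ∈ s then x (l, 2) else x (l, 0))
        = fun l => if l ∈ insert k s then x (l, 2) else x (l, 0) := by
      ext l
      by_cases hl : l = k
      · subst hl; simp [hk, hx, h2]
      · simp [hl]
    rw [e3]
    simp [bell, h2, hne]
  · have e3 : (fun l => if l ∈ s then y (l, 2) else y (l, 0))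
        = fun l => if l ∈ insert k s then x (l, 2) else x (l, 0) := by
      ext l
      by_cases hl : l = k
      · subst hl; simp [hk, hx, hy0, hflip _ _ h2]
      · simp [hl, hy l hl]
    rw [e3]
    simp [bell, h2, hflip _ _ h2]

/-- Projecting the first two qubits of a sector onto the Bell state teleports that sector. -/
theorem partialState_insert {s : Finset (Fin n)} {k : Fin n} (hk : k ∉ s) (ψ : QState (Fin n)) :
    (partialState s ψ + act (finalTerm (k, true)) (partialState s ψ))
      + act (finalTerm (k, false)) (partialState s ψ + act (finalTerm (k, true)) (partialState s ψ))
      = (2 : ℂ) • partialState (insert k s) ψ := by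
  have hX : ∀ (f : QState (Qubits n)) x, act (finalTerm (k, true)) f x =
      f (Function.update (Function.update x (k, 0) (x (k, 0) + 1)) (k, 1) (x (k, 1) + 1)) :=
    fun f x => pauliX_pair_mulVec (by simp) f.ofLp x
  have hZ : ∀ (f : QState (Qubits n)) x, act (finalTerm (k, false)) f x =
      bitSign (x (k, 0)) * bitSign (x (k, 1)) * f x :=
    fun f x => pauliZ_pair_mulVec _ _ f.ofLp x
  ext x
  rw [PiLp.add_apply, hZ, PiLp.add_apply, hX, PiLp.smul_apply, smul_eq_mul]
  by_cases hx : x (k, 0) = x (k, 1)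
  · rw [partialState_add_flip hk ψ hx (fun l hl i => by simp [hl]) (by simp) (by simp) (by simp),
      hx, bitSign_mul_self]
    ring
  · rw [bitSign_mul_of_ne hx]
    have : partialState (insert k s) ψ x = 0 := by
      simp only [partialState]
      rw [Finset.prod_eq_zero (Finset.mem_univ k) (by simp [bell, hx]), mul_zero]
    rw [this]
    ring

/-- Uniformity in the input needs only some common bound, which linearity in finite dimension
supplies. -/
theorem exists_norm_inputState_le :
    ∃ M : ℝ, ∀ ψ : QState (Fin n), ‖ψ‖ = 1 → ‖inputState ψ‖ ≤ M := by
  let L : QState (Fin n) →ₗ[ℂ] QState (Qubits n) :=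
    { toFun := inputState
      map_add' := fun ψ χ => by ext x; simp [inputState, add_mul]
      map_smul' := fun c ψ => by ext x; simp [inputState, mul_assoc] }
  refine ⟨‖LinearMap.toContinuousLinearMap L‖, fun ψ hψ => ?_⟩
  have h := (LinearMap.toContinuousLinearMap L).le_opNorm ψ
  rwa [hψ, mul_one] at h

end Endpoints

end AdiabaticTeleportation

/-! ### The adiabatic theorem for anticommuting pairs. -/

section AdiabaticPairs

open Set Complex

variable {E : Type*} [NormedAddCommGroup E] [InnerProductSpace ℂ E] [CompleteSpace E]
  [NormedSpace ℝ E] [IsScalarTower ℝ ℂ E] {ι : Type*} [Fintype ι] {A D : ι → E →L[ℂ] E}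

namespace AnticommutingPairs

/-- The adiabatic theorem for a sum of independent rotating spins: the joint ground states of the
involutions `A j` are transported by the spin rotation. -/
theorem exists_phase_adiabatic (h : AnticommutingPairs A D) (hA : ∀ j, star (A j) = A j)
    (hD : ∀ j, star (D j) = D j) {ρ ξ ξ' : ℝ → ℝ} (hρ : ContinuousOn ρ (Icc 0 1))
    (hpos : ∀ s ∈ Icc (0 : ℝ) 1, 0 < ρ s) (hξc : ContinuousOn ξ' (Icc 0 1)) (hξ0 : ξ 0 = 0)
    (hξ : ∀ s ∈ Icc (0 : ℝ) 1, HasDerivWithinAt ξ (ξ' s) (Icc 0 1) s) (M : ℝ) :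
    ∃ θ : ℝ → ℝ, ∀ δ : ℝ, 0 < δ → ∃ T : ℝ, 0 < T ∧ ∀ τ : ℝ, T ≤ τ → ∀ (χ : E) (φ : ℝ → E),
      (∀ j, A j χ = χ) → ‖χ‖ ≤ M → φ 0 = χ →
      (∀ s ∈ Icc (0 : ℝ) 1, HasDerivWithinAt φ ((I * τ * ρ s) •
        (∑ j, (cos (ξ s) • A j + sin (ξ s) • D j)) (φ s)) (Icc 0 1) s) →
      ‖φ 1 - exp (I * θ τ) • NormedSpace.exp (((ξ 1 / 2 : ℝ) : ℂ) • ∑ j, D j * A j) χ‖ ≤ δ := by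
  let := NormedAlgebra.restrictScalars ℚ ℂ (E →L[ℂ] E)
  set J := ∑ j, D j * A j with hJdef
  have hJ : star J = -J := by
    rw [hJdef, star_sum, ← Finset.sum_neg_distrib]
    refine Finset.sum_congr rfl fun j _ => ?_
    rw [star_mul, hA, hD, h.anti]
  have hS : ∀ s : ℝ, star (∑ j, (cos (ξ s) • A j + sin (ξ s) • D j))
      = ∑ j, (cos (ξ s) • A j + sin (ξ s) • D j) := fun s => by
    rw [star_sum]
    refine Finset.sum_congr rfl fun j _ => ?_
    rw [star_add, star_smul, star_smul, hA, hD, ← ofReal_cos, ← ofReal_sin]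
    simp only [RCLike.star_def, conj_ofReal]
  obtain ⟨θ, hθ⟩ := _root_.exists_phase_adiabatic (q := fun s => ξ' s / 2) hρ (hξc.div_const 2) hpos
    (S := fun s => ∑ j, (cos (ξ s) • A j + sin (ξ s) • D j))
    (fun s _ x y => by
      rw [← ContinuousLinearMap.adjoint_inner_right, ← ContinuousLinearMap.star_eq_adjoint, hS])
    (J := J) (fun x y => by
      rw [← ContinuousLinearMap.adjoint_inner_right, ← ContinuousLinearMap.star_eq_adjoint, hJ,
        _root_.neg_apply, inner_neg_right]) (Fintype.card ι) M
  refine ⟨θ, fun δ hδ => ?_⟩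
  obtain ⟨T, hT, hTτ⟩ := hθ δ hδ
  refine ⟨T, hT, fun τ hτ χ φ hχ hM h0 hφ => ?_⟩
  set W : ℝ → E →L[ℂ] E := fun s => NormedSpace.exp (((ξ s / 2 : ℝ) : ℂ) • J) with hW
  have hSW : ∀ s, (∑ j, (cos (ξ s) • A j + sin (ξ s) • D j)) * W s = W s * ∑ j, A j := fun s => by
    have := rotated_mul_exp_smul h.sum_rot_mul_sum_left h.sum_rot_mul_sum_right (ξ s)
    rw [Finset.sum_add_distrib, ← Finset.smul_sum, ← Finset.smul_sum]
    simpa [hW] using this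
  have hJW : ∀ s, J * W s = W s * J := fun s =>
    (((Commute.refl J).smul_right _).exp_right).eq
  have hGχ : (∑ j, A j) χ = (Fintype.card ι : ℂ) • χ := by
    rw [_root_.sum_apply, Finset.sum_congr rfl fun j _ => hχ j]
    simp [← Nat.cast_smul_eq_nsmul ℂ]
  have hFχ : (∑ j, D j) χ = J χ := by
    rw [hJdef, _root_.sum_apply, _root_.sum_apply]
    exact Finset.sum_congr rfl fun j _ => by rw [mul_apply_eq_comp, hχ]
  -- Since `J G = G J + 2 F` and `F χ = J χ`, where `G = ∑ A j` and `F = ∑ D j`, the vector `J χ`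
  -- lies in the level `N - 2`.
  have hGJχ : (∑ j, A j) (J χ) = ((Fintype.card ι - 2 : ℝ) : ℂ) • J χ := by
    have h1 := congrArg (fun T : E →L[ℂ] E => T χ) h.sum_rot_mul_sum_left
    simp only [mul_apply_eq_comp, _root_.add_apply, two_mul] at h1
    rw [hFχ, hGχ, map_smul] at h1
    rw [eq_comm, ← eq_sub_iff_add_eq, ← hJdef] at h1
    rw [h1]
    push_cast
    module
  have hJΩ : ∀ s, J (W s χ) = W s (J χ) := fun s => by
    rw [← mul_apply_eq_comp, hJW, mul_apply_eq_comp]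
  have hW0 : W 0 χ = χ := by simp [hW, hξ0]
  refine hTτ τ hτ (fun s => W s χ) φ (fun s hs => ?_) (fun s _ => ?_) (fun s _ => ?_) hφ
    (h0.trans hW0.symm) (by rwa [hW0])
  · have h1 : HasDerivAt (fun z : ℂ => NormedSpace.exp (z • J) χ)
        (J (NormedSpace.exp (((ξ s / 2 : ℝ) : ℂ) • J) χ)) ((ξ s / 2 : ℝ) : ℂ) := by
      have := (hasDerivAt_exp_smul_const' J ((ξ s / 2 : ℝ) : ℂ)).clm_apply
        (hasDerivAt_const ((ξ s / 2 : ℝ) : ℂ) χ)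
      simpa using this
    exact h1.scomp_hasDerivWithinAt s ((hξ s hs).div_const 2).ofReal_comp
  · rw [← mul_apply_eq_comp, hSW, mul_apply_eq_comp, hGχ, map_smul]
    simp
  · rw [hJΩ, ← mul_apply_eq_comp, hSW, mul_apply_eq_comp, hGJχ, map_smul]

end AnticommutingPairs

end AdiabaticPairs

/-! ### Ground energy and gap. -/

namespace AdiabaticTeleportation

section Spectrum

variable {κ ι : Type*} [Fintype κ] [DecidableEq κ] [Fintype ι]

theorem mem_energies_iff {H : QOp κ} {E : ℝ} :
    E ∈ energies H ↔ ∃ v, v ≠ 0 ∧ Matrix.toLin' H v = (E : ℂ) • v := by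
  constructor
  · intro hE
    obtain ⟨v, hv⟩ := Module.End.HasEigenvalue.exists_hasEigenvector hE
    exact ⟨v, hv.2, hv.apply_eq_smul⟩
  · rintro ⟨v, hv, hE⟩
    exact Module.End.hasEigenvalue_of_hasEigenvector
      (Module.End.hasEigenvector_iff.2 ⟨Module.End.mem_eigenspace_iff.2 hE, hv⟩)

/-- All energies lie on a ladder of step `2 c r`. A joint ground vector occupies its lowest rung,
and one flip of it the next. -/
theorem hasGroundEnergyAndGap_of_pairs [Nonempty ι] {A D : ι → QOp κ} (h : AnticommutingPairs A D)
    {a b c r : ℝ} (hc : 0 < c) (hr : 0 < r) (hab : a ^ 2 + b ^ 2 = r ^ 2) {H : QOp κ}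
    (hH : H = (-(c : ℂ)) • ∑ j, ((a : ℂ) • A j + (b : ℂ) • D j)) :
    HasGroundEnergyAndGap H (-(Fintype.card ι * (c * r))) (2 * (c * r)) := by
  have h' := h.map (Matrix.toLinAlgEquiv' (R := ℂ) (n := κ → Fin 2))
  have hab' : (a : ℂ) ^ 2 + (b : ℂ) ^ 2 = (r : ℂ) ^ 2 := by exact_mod_cast hab
  have hr' : (r : ℂ) ≠ 0 := by exact_mod_cast hr.ne'
  have hc' : (c : ℂ) ≠ 0 := by exact_mod_cast hc.ne'
  have hlin : Matrix.toLin' H = (-(c : ℂ)) • ∑ j, ((a : ℂ) • Matrix.toLinAlgEquiv' (A j)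
      + (b : ℂ) • Matrix.toLinAlgEquiv' (D j)) := by
    rw [hH, map_smul, map_sum]
    simp only [map_add, map_smul]
    rfl
  have hform : ∀ E ∈ energies H, ∃ m : ℕ, E = -(Fintype.card ι * (c * r)) + m * (2 * (c * r)) := by
    intro E hE
    obtain ⟨v, hv, hEv⟩ := mem_energies_iff.1 hE
    rw [hlin, LinearMap.smul_apply] at hEv
    have hSv : (∑ j, ((a : ℂ) • Matrix.toLinAlgEquiv' (A j)
        + (b : ℂ) • Matrix.toLinAlgEquiv' (D j))) v = (-(E / c) : ℂ) • v := by
      rw [← inv_smul_smul₀ (neg_ne_zero.2 hc') ((∑ j, ((a : ℂ) • Matrix.toLinAlgEquiv' (A j)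
        + (b : ℂ) • Matrix.toLinAlgEquiv' (D j))) v), hEv, smul_smul]
      congr 1
      field_simp
    obtain ⟨m, hm⟩ := h'.exists_eigenvalue_eq hab' hv hSv hr'
    refine ⟨m, ?_⟩
    have h1 : -(E / c) = (Fintype.card ι - 2 * m) * r := by exact_mod_cast hm
    have h2 : E = -(-(E / c)) * c := by field_simp
    rw [h2, h1]
    ring
  obtain ⟨v, hv, hvj⟩ := h'.exists_ground_vector hab' hr' Finset.univ
  have hvj' := fun j => hvj j (Finset.mem_univ j)
  obtain ⟨i⟩ := ‹Nonempty ι›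
  have hcr : 0 < c * r := mul_pos hc hr
  refine ⟨⟨mem_energies_iff.2 ⟨v, hv, ?_⟩, fun E hE => ?_⟩,
    ⟨⟨mem_energies_iff.2 ⟨_, h'.rot_apply_ne_zero i hv, ?_⟩, by linarith⟩, fun E hE => ?_⟩⟩
  · rw [hlin, LinearMap.smul_apply, LinearMap.sum_apply, Finset.sum_congr rfl fun j _ => hvj' j,
      ← Finset.sum_smul, smul_smul]
    congr 1
    simp
    ring
  · obtain ⟨m, rfl⟩ := hform E hE
    have : 0 ≤ (m : ℝ) * (2 * (c * r)) := by positivity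
    linarith
  · rw [hlin, LinearMap.smul_apply, h'.sum_combination_apply_rot hvj' i, smul_smul]
    congr 1
    push_cast
    ring
  · obtain ⟨m, rfl⟩ := hform E hE.1
    have h1 : m ≠ 0 := by
      rintro rfl
      simpa using hE.2
    have h2 : (1 : ℝ) ≤ m := by exact_mod_cast Nat.one_le_iff_ne_zero.2 h1
    nlinarith

end Spectrum

/-! ### The frame rotated by the gate, and teleportation by the spin rotation. -/

section Rotated

variable {n : ℕ} {U : QOp (Fin n)} (hU : U ∈ unitaryGroup (Fin n → Fin 2) ℂ)

/-- The rotation by a unitary gate on the receiver's qubits as an automorphism. -/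
noncomputable def rotation : QOp (Qubits n) ≃⋆ₐ[ℂ] QOp (Qubits n) :=
  Unitary.conjStarAlgAut ℂ _ ⟨receiverGate U, receiverGate_mem_unitary hU⟩

theorem rotation_apply (A : QOp (Qubits n)) : rotation hU A = rotated U A := rfl

theorem rotated_Hmult (ω ħ : ℝ) (ηi ηf : ℝ → ℝ) (s : ℝ) :
    rotated U (Hmult n ω ħ ηi ηf s) = (-(ω * ħ : ℂ)) •
      ∑ j, ((ηi s : ℂ) • rotation hU (initialTerm j) + (ηf s : ℂ) • rotation hU (finalTerm j)) := by
  rw [← rotation_apply hU, Hmult_eq, map_smul, map_sum]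
  simp only [map_add, map_smul]

/-- Operators on the register as operators on states, in the frame rotated by the gate. -/
noncomputable def rotatedAct :
    QOp (Qubits n) ≃⋆ₐ[ℂ] (QState (Qubits n) →L[ℂ] QState (Qubits n)) :=
  (rotation hU).trans Matrix.toEuclideanCLM

theorem rotatedAct_apply (A : QOp (Qubits n)) (ψ : QState (Qubits n)) :
    rotatedAct hU A ψ = act (rotated U A) ψ := rfl

theorem act_mul {ι : Type*} [Fintype ι] [DecidableEq ι] (A B : QOp ι) (ψ : QState ι) :
    act (A * B) ψ = act A (act B ψ) := by
  simp only [act, map_mul]; rfl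

include hU in
theorem act_rotated_act_receiverGate (A : QOp (Qubits n)) (ψ : QState (Qubits n)) :
    act (rotated U A) (act (receiverGate U) ψ) = act (receiverGate U) (act A ψ) := by
  rw [← act_mul, ← act_mul, rotated, mul_assoc _ (receiverGate U)ᴴ, ← star_eq_conjTranspose,
    (Unitary.mem_iff.1 (receiverGate_mem_unitary hU)).1, mul_one]

theorem star_rotatedAct_initialTerm (j : Fin n × Bool) :
    star (rotatedAct hU (initialTerm j)) = rotatedAct hU (initialTerm j) := by
  rw [← map_star, star_eq_conjTranspose, conjTranspose_initialTerm]

theorem star_rotatedAct_finalTerm (j : Fin n × Bool) :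
    star (rotatedAct hU (finalTerm j)) = rotatedAct hU (finalTerm j) := by
  rw [← map_star, star_eq_conjTranspose, conjTranspose_finalTerm]

theorem anticommutingPairs_rotatedAct : AnticommutingPairs
    (fun j : Fin n × Bool => rotatedAct hU (initialTerm j)) fun j => rotatedAct hU (finalTerm j) :=
  anticommutingPairs_terms.map (rotatedAct hU)

/-- The spin rotation by the angle `π / 4` teleports the sectors one by one. -/
theorem exp_rot_inputState (ψ : QState (Fin n)) {x : ℂ} (hx : Complex.cos x = Complex.sin x)
    (s : Finset (Fin n)) :
    NormedSpace.exp (x • ∑ j ∈ s ×ˢ (Finset.univ : Finset Bool),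
        rotatedAct hU (finalTerm j) * rotatedAct hU (initialTerm j))
      (act (receiverGate U) (inputState ψ)) = act (receiverGate U) (partialState s ψ) := by
  -- The two spins of a sector contribute `cos x` twice, cancelling the factor 2 of
  -- `partialState_insert`. Only the square enters, so the sign of `cos x` is immaterial.
  have hsq : Complex.cos x * Complex.cos x * 2 = 1 := by
    have := Complex.sin_sq_add_cos_sq x
    rw [← hx] at this
    linear_combination this
  have hA : ∀ j, rotatedAct hU (initialTerm j) (act (receiverGate U) (inputState ψ))
      = act (receiverGate U) (inputState ψ) := fun j => by
    rw [rotatedAct_apply, act_rotated_act_receiverGate hU, act_initialTerm_inputState]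
  have hadd : ∀ f g : QState (Qubits n),
      act (receiverGate U) f + act (receiverGate U) g = act (receiverGate U) (f + g) :=
    fun f g => (map_add _ _ _).symm
  have hsmul : ∀ (c : ℂ) (f : QState (Qubits n)),
      c • act (receiverGate U) f = act (receiverGate U) (c • f) :=
    fun c f => (map_smul _ _ _).symm
  induction s using Finset.induction_on with
  | empty => simp [partialState_empty]
  | insert k s hk ih =>
    have hset : insert k s ×ˢ (Finset.univ : Finset Bool)
        = insert (k, false) (insert (k, true) (s ×ˢ Finset.univ)) := by
      ext ⟨l, b⟩
      cases b <;> simp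
    have h1 : (k, true) ∉ s ×ˢ (Finset.univ : Finset Bool) := by simp [hk]
    have h2 : (k, false) ∉ insert (k, true) (s ×ˢ (Finset.univ : Finset Bool)) := by simp [hk]
    have hp := anticommutingPairs_rotatedAct hU
    rw [hset, hp.exp_insert_apply h2 x (hA _), hp.exp_insert_apply h1 x (hA _), ih, ← hx,
      ← smul_add, ← smul_add, map_smul, ← smul_add, smul_smul, map_add]
    simp only [rotatedAct_apply, act_rotated_act_receiverGate hU, hadd]
    have h3 := partialState_insert hk ψ
    have h4 : act (finalTerm (k, false)) (partialState s ψ + act (finalTerm (k, true))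
        (partialState s ψ)) = act (finalTerm (k, false)) (partialState s ψ)
        + act (finalTerm (k, false)) (act (finalTerm (k, true)) (partialState s ψ)) :=
      map_add _ _ _
    rw [h4] at h3
    rw [h3, ← hsmul, smul_smul, hsq, one_smul]

end Rotated

/-! ### The Schrödinger equation and its rescaling. -/

section Evolution

variable {n : ℕ} {U : QOp (Fin n)} (hU : U ∈ unitaryGroup (Fin n → Fin 2) ℂ)

theorem rotatedAct_Hmult (ω ħ : ℝ) (ηi ηf : ℝ → ℝ) (s : ℝ) :
    rotatedAct hU (Hmult n ω ħ ηi ηf s) = (-(ω * ħ : ℂ)) •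
      ∑ j, ((ηi s : ℂ) • rotatedAct hU (initialTerm j)
        + (ηf s : ℂ) • rotatedAct hU (finalTerm j)) := by
  rw [Hmult_eq, map_smul, map_sum]
  simp only [map_add, map_smul]

theorem conjTranspose_Hmult (ω ħ : ℝ) (ηi ηf : ℝ → ℝ) (s : ℝ) :
    (Hmult n ω ħ ηi ηf s)ᴴ = Hmult n ω ħ ηi ηf s := by
  rw [Hmult_eq, conjTranspose_smul, conjTranspose_sum]
  simp only [conjTranspose_add, conjTranspose_smul, conjTranspose_initialTerm,
    conjTranspose_finalTerm, star_neg, star_mul', RCLike.star_def, Complex.conj_ofReal]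

theorem star_rotatedAct_Hmult (ω ħ : ℝ) (ηi ηf : ℝ → ℝ) (s : ℝ) :
    star (rotatedAct hU (Hmult n ω ħ ηi ηf s)) = rotatedAct hU (Hmult n ω ħ ηi ηf s) := by
  rw [← map_star, star_eq_conjTranspose, conjTranspose_Hmult]

theorem Hmult_eq_of_polar {ω ħ r ξ : ℝ} {ηi ηf : ℝ → ℝ} {s : ℝ} (hi : ηi s = r * Real.cos ξ)
    (hf : ηf s = r * Real.sin ξ) : Hmult n ω ħ ηi ηf s = (-(ω * ħ * r : ℂ)) •
      ∑ j, (Complex.cos ξ • initialTerm j + Complex.sin ξ • finalTerm j) := by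
  rw [Hmult_eq, hi, hf, Finset.smul_sum, Finset.smul_sum]
  refine Finset.sum_congr rfl fun j _ => ?_
  push_cast
  module

theorem continuousOn_rotatedAct_Hmult (ω ħ : ℝ) {ηi ηf : ℝ → ℝ} {I : Set ℝ}
    (hi : ContinuousOn ηi I) (hf : ContinuousOn ηf I) :
    ContinuousOn (fun s => rotatedAct hU (Hmult n ω ħ ηi ηf s)) I := by
  have hi' : ContinuousOn (fun s => (ηi s : ℂ)) I := Complex.continuous_ofReal.comp_continuousOn hi
  have hf' : ContinuousOn (fun s => (ηf s : ℂ)) I := Complex.continuous_ofReal.comp_continuousOn hf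
  simp only [rotatedAct_Hmult]
  fun_prop

include hU in
theorem exists_isEvolution (ω ħ : ℝ) {ηi ηf : ℝ → ℝ} (hi : ContinuousOn ηi (Set.Icc 0 1))
    (hf : ContinuousOn ηf (Set.Icc 0 1)) {τ : ℝ} (hτ : 0 < τ) (φ₀ : QState (Qubits n)) :
    ∃ φ, IsEvolution ħ τ (fun s => rotated U (Hmult n ω ħ ηi ηf s)) φ₀ φ := by
  have hmaps : Set.MapsTo (fun t => t / τ) (Set.Icc 0 τ) (Set.Icc 0 1) := fun t ht =>
    ⟨div_nonneg ht.1 hτ.le, (div_le_one hτ).2 ht.2⟩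
  obtain ⟨φ, h0, hφ⟩ := exists_solution_of_skew hτ.le
    (L := fun t => (-(Complex.I / (ħ : ℂ))) • rotatedAct hU (Hmult n ω ħ ηi ηf (t / τ)))
    (ContinuousOn.fun_const_smul ((continuousOn_rotatedAct_Hmult hU ω ħ hi hf).comp
      (continuous_id.div_const τ).continuousOn hmaps) _)
    (fun t _ y => by
      have h1 : inner ℂ (rotatedAct hU (Hmult n ω ħ ηi ηf (t / τ)) y) y
          = inner ℂ y (rotatedAct hU (Hmult n ω ħ ηi ηf (t / τ)) y) := by
        rw [← ContinuousLinearMap.adjoint_inner_right, ← ContinuousLinearMap.star_eq_adjoint,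
          star_rotatedAct_Hmult]
      have h2 := congrArg Complex.im h1
      rw [← inner_conj_symm, Complex.conj_im] at h2
      rw [_root_.smul_apply, inner_smul_right,
        show -(Complex.I / (ħ : ℂ)) = ((-ħ⁻¹ : ℝ) : ℂ) * Complex.I by push_cast; ring,
        mul_assoc, Complex.re_ofReal_mul, Complex.I_mul_re,
        show (inner ℂ y (rotatedAct hU (Hmult n ω ħ ηi ηf (t / τ)) y)).im = 0 by linarith]
      simp) φ₀
  exact ⟨φ, h0, hφ⟩

include hU in
/-- On the rescaled time interval, the evolution is driven by a sum of rotating spins. -/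
theorem IsEvolution.hasDerivWithinAt_rescaled {ω ħ : ℝ} (hħ : 0 < ħ) {ηi ηf r ξ : ℝ → ℝ}
    (hpolar : ∀ s ∈ Set.Icc (0 : ℝ) 1,
      ηi s = r s * Real.cos (ξ s) ∧ ηf s = r s * Real.sin (ξ s))
    {τ : ℝ} (hτ : 0 < τ) {φ₀ : QState (Qubits n)} {φ : ℝ → QState (Qubits n)}
    (hφ : IsEvolution ħ τ (fun s => rotated U (Hmult n ω ħ ηi ηf s)) φ₀ φ) {s : ℝ}
    (hs : s ∈ Set.Icc (0 : ℝ) 1) :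
    HasDerivWithinAt (fun s => φ (τ * s)) ((Complex.I * τ * (ω * r s : ℝ)) •
      (∑ j, (Complex.cos (ξ s) • rotatedAct hU (initialTerm j)
        + Complex.sin (ξ s) • rotatedAct hU (finalTerm j))) (φ (τ * s))) (Set.Icc 0 1) s := by
  have hmem : ∀ s ∈ Set.Icc (0 : ℝ) 1, τ * s ∈ Set.Icc 0 τ := fun s hs =>
    ⟨mul_nonneg hτ.le hs.1, by nlinarith [hs.2]⟩
  have h1 := (hφ.2 (τ * s) (hmem s hs)).scomp s
    (((hasDerivAt_id s).const_mul τ).hasDerivWithinAt (s := Set.Icc 0 1)) hmem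
  refine h1.congr_deriv ?_
  have h2 : act (rotated U (Hmult n ω ħ ηi ηf s)) (φ (τ * s))
      = (-(ω * ħ * r s : ℂ)) • (∑ j, (Complex.cos (ξ s) • rotatedAct hU (initialTerm j)
        + Complex.sin (ξ s) • rotatedAct hU (finalTerm j))) (φ (τ * s)) := by
    rw [← rotatedAct_apply hU, Hmult_eq_of_polar (hpolar s hs).1 (hpolar s hs).2, map_smul, map_sum]
    simp only [map_add, map_smul]
    rfl
  have hħ' : (ħ : ℂ) ≠ 0 := by exact_mod_cast hħ.ne'
  -- The scalars combine as `τ · (-i/ħ) · (-ωħ r) = iτωr`.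
  rw [mul_div_cancel_left₀ s hτ.ne', h2, mul_one, ← algebraMap_smul ℂ τ, Complex.coe_algebraMap,
    smul_smul, smul_smul]
  congr 1
  push_cast
  field_simp

end Evolution

end AdiabaticTeleportation

/-! ### Assembly of the theorem. -/

open AdiabaticTeleportation in
theorem mainTheorem4 (n : ℕ) (hn : 1 ≤ n) (ω ħ : ℝ) (hω : 0 < ω) (hħ : 0 < ħ)
    (ηi ηf : ℝ → ℝ)
    (hηi : ContDiffOn ℝ 1 ηi (Set.Icc 0 1)) (hηf : ContDiffOn ℝ 1 ηf (Set.Icc 0 1))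
    (hi0 : ηi 0 = 1) (hi1 : ηi 1 = 0) (hf0 : ηf 0 = 0) (hf1 : ηf 1 = 1)
    (hne : ∀ s ∈ Set.Icc (0 : ℝ) 1, ¬ (ηi s = 0 ∧ ηf s = 0))
    (U : QOp (Fin n)) (hU : U ∈ Matrix.unitaryGroup (Fin n → Fin 2) ℂ) :
    -- the rotated parities of every sector are symmetries
    (∀ s ∈ Set.Icc (0 : ℝ) 1, ∀ k : Fin n,
      Commute (rotated U (Hmult n ω ħ ηi ηf s)) (rotated U (parityZ k)) ∧
      Commute (rotated U (Hmult n ω ħ ηi ηf s)) (rotated U (parityX k))) ∧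
    -- the ground energy and the gap
    (∀ s ∈ Set.Icc (0 : ℝ) 1,
      HasGroundEnergyAndGap (rotated U (Hmult n ω ħ ηi ηf s))
        (-(n * (2 * ω * ħ * Real.sqrt (ηi s ^ 2 + ηf s ^ 2))))
        (2 * ω * ħ * Real.sqrt (ηi s ^ 2 + ηf s ^ 2))) ∧
    -- the evolution exists for every input state and every total time
    (∀ ψ : QState (Fin n), ‖ψ‖ = 1 → ∀ τ : ℝ, 0 < τ → ∃ φ : ℝ → QState (Qubits n),
      IsEvolution ħ τ (fun s => rotated U (Hmult n ω ħ ηi ηf s))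
        (act (receiverGate U) (inputState ψ)) φ) ∧
    -- in the adiabatic limit it teleports the gate, up to a phase that does not depend on the input
    (∃ θ : ℝ → ℝ, ∀ δ : ℝ, 0 < δ → ∃ T : ℝ, 0 < T ∧ ∀ τ : ℝ, T ≤ τ →
      ∀ ψ : QState (Fin n), ‖ψ‖ = 1 → ∀ φ : ℝ → QState (Qubits n),
        IsEvolution ħ τ (fun s => rotated U (Hmult n ω ħ ηi ηf s))
          (act (receiverGate U) (inputState ψ)) φ →
        ‖φ τ - Complex.exp (Complex.I * (θ τ : ℂ)) • outputState (act U ψ)‖ ≤ δ) := by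
  have hpos : ∀ s ∈ Set.Icc (0 : ℝ) 1, 0 < Real.sqrt (ηi s ^ 2 + ηf s ^ 2) := by
    intro s hs
    refine Real.sqrt_pos.2 ?_
    rcases not_and_or.1 (hne s hs) with h | h <;> positivity
  refine ⟨fun s _ k => ?_, fun s hs => ?_, fun ψ _ τ hτ => ?_, ?_⟩
  · have h := commute_Hmult_parity (n := n) ω ħ ηi ηf s k
    exact ⟨h.1.map (rotation hU), h.2.map (rotation hU)⟩
  · have : Nonempty (Fin n × Bool) := ⟨(⟨0, hn⟩, true)⟩
    have h := hasGroundEnergyAndGap_of_pairs (anticommutingPairs_terms.map (rotation hU))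
      (mul_pos hω hħ) (hpos s hs) (Real.sq_sqrt (by positivity)).symm
      ((rotated_Hmult hU ω ħ ηi ηf s).trans (by push_cast; rfl))
    convert h using 1
    · simp only [Fintype.card_prod, Fintype.card_fin, Fintype.card_bool]
      push_cast
      ring
    · ring
  · exact exists_isEvolution hU ω ħ hηi.continuousOn hηf.continuousOn hτ _
  · obtain ⟨ξ, ξ', hξc, hξ0, hξ, hpolar⟩ := exists_polar_angle hηi hηf hi0 hf0 hne
    obtain ⟨M, hM⟩ := exists_norm_inputState_le (n := n)
    have hρ : ContinuousOn (fun s => ω * Real.sqrt (ηi s ^ 2 + ηf s ^ 2)) (Set.Icc 0 1) :=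
      continuousOn_const.mul (((hηi.continuousOn.pow 2).add (hηf.continuousOn.pow 2)).sqrt)
    obtain ⟨θ, hθ⟩ := (anticommutingPairs_rotatedAct hU).exists_phase_adiabatic
      (star_rotatedAct_initialTerm hU) (star_rotatedAct_finalTerm hU) hρ
      (fun s hs => mul_pos hω (hpos s hs)) hξc hξ0 hξ
      (‖Matrix.toEuclideanCLM (n := Qubits n → Fin 2) (𝕜 := ℂ) (receiverGate U)‖ * M)
    refine ⟨θ, fun δ hδ => ?_⟩
    obtain ⟨T, hT, h⟩ := hθ δ hδ
    refine ⟨T, hT, fun τ hτ ψ hψ φ hφ => ?_⟩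
    have key := h τ hτ (act (receiverGate U) (inputState ψ)) (fun s => φ (τ * s))
      (fun j => by
        rw [rotatedAct_apply, act_rotated_act_receiverGate hU, act_initialTerm_inputState])
      ((ContinuousLinearMap.le_opNorm _ _).trans
        (mul_le_mul_of_nonneg_left (hM ψ hψ) (norm_nonneg _)))
      (by rw [mul_zero]; exact hφ.1)
      (fun s hs => hφ.hasDerivWithinAt_rescaled hU hħ hpolar (hT.trans_le hτ) hs)
    -- The curve may wind around the origin, so `ξ 1` is known only modulo `2π`. From `sin (ξ 1) =
    -- 1` one gets `(cos (ξ 1 / 2) - sin (ξ 1 / 2))² = 0`, which is enough.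
    have hcs : Complex.cos ((ξ 1 / 2 : ℝ) : ℂ) = Complex.sin ((ξ 1 / 2 : ℝ) : ℂ) := by
      have h1 := (hpolar 1 (by simp)).2
      rw [hi1, hf1] at h1
      norm_num at h1
      have h2 := Real.sin_two_mul (ξ 1 / 2)
      rw [mul_div_cancel₀ _ two_ne_zero, ← h1] at h2
      have h3 : Real.cos (ξ 1 / 2) = Real.sin (ξ 1 / 2) := by
        nlinarith [Real.sin_sq_add_cos_sq (ξ 1 / 2),
          sq_nonneg (Real.cos (ξ 1 / 2) - Real.sin (ξ 1 / 2))]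
      rw [← Complex.ofReal_cos, ← Complex.ofReal_sin, h3]
    have hend := exp_rot_inputState hU ψ hcs Finset.univ
    rw [Finset.univ_product_univ, partialState_univ, act_receiverGate_outputState] at hend
    rwa [hend, mul_one] at key
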